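/- Let $T\ge 1$, $\alpha>2$ and $\mu>0$. For $i=1,\dots,T$ let $\lambda_i,P_i,\beta_i>0$ and $N_0^i\ge 0$, and let $\phi_i$ be a homogeneous Poisson point process on $\mathbb{R}^2$ of intensity $\lambda_i$ (the base stations of technology $i$). Let $r_j^i$ be the distance from the origin to the $j$-th nearest point of $\phi_i$, and let $H_j^i$ ($j\ge1$) be exponential random variables with mean $\mu^{-1}$ (Rayleigh fading). The processes $\phi_1,\dots,\phi_T$ and all the $H_j^i$ are jointly independent. Put $$\mathrm{SINR}^{i,j}=\frac{P_iH_j^i(r_j^i)^{-\alpha}}{N_0^i+\sum_{k\ne j}P_iH_k^i(r_k^i)^{-\alpha}} .$$ An association policy using the information $\mathcal{F}$ (a $\sigma$-algebra) is an $\mathcal{F}$-measurable map $\pi=(\pi(0),\pi(1)):\Omega\to\{1,\dots,T\}\times\{1,2,\dots\}$, choosing a technology and the rank of a station in it. Its coverage probability is $\mathbb{P}[\mathrm{SINR}^{\pi(0),\pi(1)}\ge\beta_{\pi(0)}]$. Let $\mathcal{U}$ be a $\sigma$-algebra independent of all the $\phi_i$ and $H^i_j$ (additional randomness that policies may use; it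 may be trivial). The integrals below converge for all $r_1,r_2>0$. (1) Put $$c_p(1;r_1,\lambda,P,N_0,\beta)=e^{-\mu\beta N_0r_1^\alpha/P}\exp\Bigl(-2\pi\lambda\int_{r_1}^\infty\frac{u\,du}{1+\beta^{-1}(u/r_1)^\alpha}\Bigr).$$ Then for every $i$, almost surely, $$\mathbb{P}[\mathrm{SINR}^{i,1}\ge\beta_i\mid r_1^i]=c_p(1;r_1^i,\lambda_i,P_i,N_0^i,\beta_i),$$ and the same holds when the conditioning is on $\mathcal{F}_1=\sigma(r_1^l:1\le l\le T)\vee\mathcal{U}$. There is an $\mathcal{F}_1$-measurable policy that almost surely chooses the nearest station of a technology $i^*\in\arg\max_i c_p(1;r_1^i,\lambda_i,P_i,N_0^i,\beta_i)$, and every such policy maximizes the coverage probability among all $\mathcal{F}_1$-measurable policies. (2) Put $$c_p(1;[r_1,r_2],\lambda,P,N_0,\beta)=e^{-\mu\beta N_0r_1^\alpha/P}\,\frac{1}{1+\beta(r_1/r_2)^\alpha}\,\exp\Bigl(-2\pi\lambda\int_{r_2}^\infty\frac{u\,du}{1+\beta^{-1}(u/r_1)^\alpha}\Bigr).$$ Then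 for every $i$, almost surely, $$\mathbb{P}[\mathrm{SINR}^{i,1}\ge\beta_i\mid r_1^i,r_2^i]=c_p(1;[r_1^i,r_2^i],\lambda_i,P_i,N_0^i,\beta_i),$$ and the same holds when the conditioning is on $\mathcal{F}_2=\sigma(r_1^l,r_2^l:1\le l\le T)\vee\mathcal{U}$. There is an $\mathcal{F}_2$-measurable policy that almost surely chooses the nearest station of a technology $i^*\in\arg\max_i c_p(1;[r_1^i,r_2^i],\lambda_i,P_i,N_0^i,\beta_i)$, and every such policy maximizes the coverage probability among all $\mathcal{F}_2$-measurable policies. -/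

import Mathlib

open MeasureTheory ProbabilityTheory

namespace CellularNetwork

noncomputable section

/-- The plane `ℝ²` with its Euclidean norm; the typical user sits at the origin. -/
abbrev Plane : Type := EuclideanSpace ℝ (Fin 2)

/-- The number of points of the random set `φ` in `B`. -/
def pointCount {Ω : Type*} (φ : Ω → Set Plane) (B : Set Plane) (ω : Ω) : ℕ∞ :=
  (φ ω ∩ B).encard

/-- `φ` is a homogeneous Poisson point process on the plane with intensity `lam`: counts are
random variables, the count in a Borel set `B` of finite area is Poisson with mean
`lam * area B`, and counts in pairwise disjoint Borel sets are independent. -/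
structure IsPoissonPointProcess {Ω : Type*} [MeasurableSpace Ω] (Pr : Measure Ω)
    (φ : Ω → Set Plane) (lam : ℝ) : Prop where
  measurable_count : ∀ B : Set Plane, MeasurableSet B → Measurable (pointCount φ B)
  law_count : ∀ B : Set Plane, MeasurableSet B → volume B ≠ ⊤ →
    Pr.map (pointCount φ B) =
      (poissonMeasure (Real.toNNReal (lam * volume.real B))).map (fun n : ℕ => (n : ℕ∞))
  indep_count : ∀ (n : ℕ) (B : Fin n → Set Plane), (∀ k, MeasurableSet (B k)) →
    Pairwise (fun k l => Disjoint (B k) (B l)) → iIndepFun (fun k => pointCount φ (B k)) Pr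

/-- The σ-algebra generated by the point process `φ`, i.e. by all its counts in Borel sets. -/
@[reducible] def pointSigma {Ω : Type*} (φ : Ω → Set Plane) : MeasurableSpace Ω :=
  ⨆ (B : Set Plane) (_ : MeasurableSet B), MeasurableSpace.comap (pointCount φ B) ⊤

/-- Distance from the origin to the `(k+1)`-th nearest point of `S` (points at equal distance are
counted with multiplicity): the least radius whose closed ball holds more than `k` points. -/
def nthDist (S : Set Plane) (k : ℕ) : ℝ :=
  sInf {ρ : ℝ | 0 ≤ ρ ∧ (k : ℕ∞) < (S ∩ Metric.closedBall 0 ρ).encard}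

/-- The data of a downlink network with `T` technologies. Technologies are indexed by `Fin T`, and
the base stations of each technology are ranked by distance from the origin, starting with rank `0`
for the nearest one. -/
structure Network (T : ℕ) (Ω : Type*) where
  /-- path-loss exponent: the path loss is `r ↦ r ^ (-α)` -/
  α : ℝ
  /-- rate of the exponential fading, which has mean `μ⁻¹` -/
  μ : ℝ
  /-- intensities of the base station processes -/
  intensity : Fin T → ℝ
  /-- transmission powers -/
  power : Fin T → ℝ
  /-- thermal noise powers -/
  noise : Fin T → ℝ
  /-- SINR thresholds -/
  threshold : Fin T → ℝ
  /-- random set of base stations of each technology -/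
  stations : Fin T → Ω → Set Plane
  /-- `fading i k`: fading coefficient between the user and the station of rank `k` -/
  fading : Fin T → ℕ → Ω → ℝ

namespace Network

variable {T : ℕ} {Ω : Type*} (N : Network T Ω)

/-- The σ-algebras generated by the station processes and by the single fading coefficients. -/
@[reducible] def sourceSigma : Fin T ⊕ (Fin T × ℕ) → MeasurableSpace Ω
  | Sum.inl i => pointSigma (N.stations i)
  | Sum.inr (i, k) => MeasurableSpace.comap (N.fading i k) inferInstance

/-- Stations of technology `i` form a homogeneous Poisson process of intensity `intensity i`; all
fading coefficients are exponential of mean `μ⁻¹` (Rayleigh fading); and all these processes and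
coefficients are jointly independent. -/
structure IsPoissonRayleigh [MeasurableSpace Ω] (Pr : Measure Ω) : Prop where
  stations_ppp : ∀ i, IsPoissonPointProcess Pr (N.stations i) (N.intensity i)
  fading_measurable : ∀ i k, Measurable (N.fading i k)
  fading_law : ∀ i k, Pr.map (N.fading i k) = expMeasure N.μ
  indep : iIndep N.sourceSigma Pr

/-- Distance `r` from the user to the station of rank `k` of technology `i`. -/
def dist (i : Fin T) (k : ℕ) (ω : Ω) : ℝ := nthDist (N.stations i ω) k

/-- Power `P H r^(-α)` received from the station of rank `k` of technology `i`. -/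
def received (i : Fin T) (k : ℕ) (ω : Ω) : ENNReal :=
  ENNReal.ofReal (N.power i * N.fading i k ω * N.dist i k ω ^ (-N.α))

/-- SINR at the user when served by the station of rank `j` of technology `i`; the interference is
the sum of the powers received from all other stations of that technology, taken in `[0, ∞]`. -/
def sinr (i : Fin T) (j : ℕ) (ω : Ω) : ENNReal :=
  N.received i j ω /
    (ENNReal.ofReal (N.noise i) + ∑' k : {k : ℕ // k ≠ j}, N.received i k ω)

/-- The coverage indicator `1(SINR ≥ β)`. -/
def covered (i : Fin T) (j : ℕ) : Ω → ℝ :=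
  Set.indicator {ω | ENNReal.ofReal (N.threshold i) ≤ N.sinr i j ω} 1

/-- Information on technology `i`: σ-algebra of the distances to its `L` nearest stations. -/
@[reducible] def techInfo (L : ℕ) (i : Fin T) : MeasurableSpace Ω :=
  ⨆ k : Fin L, MeasurableSpace.comap (N.dist i k) inferInstance

/-- The distances to the `L` nearest stations of every technology. -/
@[reducible] def info (L : ℕ) : MeasurableSpace Ω := ⨆ i, N.techInfo L i

/-- The performance `E[1(SINR ≥ β)]` of an association policy `π`, which selects a technology and
the rank of a station of that technology. -/
def coverage [MeasurableSpace Ω] (Pr : Measure Ω) (π : Ω → Fin T × ℕ) : ℝ :=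
  ∫ ω, N.covered (π ω).1 (π ω).2 ω ∂Pr

/-- `π` maximizes the coverage probability among all policies that use only the information `𝓕`. -/
def IsOptimalPolicy (𝓕 : MeasurableSpace Ω) [mΩ : MeasurableSpace Ω] (Pr : Measure Ω)
    (π : Ω → Fin T × ℕ) : Prop :=
  Measurable[𝓕] π ∧
    ∀ π' : Ω → Fin T × ℕ, Measurable[𝓕] π' → N.coverage Pr π' ≤ N.coverage Pr π

end Network

/-- Almost surely, `π` selects a technology `i` that maximizes the score `c i`, and the nearest
station of that technology. -/
def FollowsRule {T : ℕ} {Ω : Type*} [MeasurableSpace Ω] (Pr : Measure Ω) (c : Fin T → Ω → ℝ)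
    (π : Ω → Fin T × ℕ) : Prop :=
  ∀ᵐ ω ∂Pr, (∀ i, c i ω ≤ c (π ω).1 ω) ∧ (π ω).2 = 0

/-- The integrand `u / (1 + β⁻¹ (u / r)^α)`. -/
def kernelFn (α β r u : ℝ) : ℝ := 1 / (1 + β⁻¹ * (u / r) ^ α) * u

/-- Coverage expression when the nearest distance `r₁` is known. -/
def coverExprOne (μ α lam P N₀ β r₁ : ℝ) : ℝ :=
  Real.exp (-(μ * β * N₀ * r₁ ^ α * P⁻¹)) *
    Real.exp (-(2 * Real.pi * lam * ∫ u in Set.Ioi r₁, kernelFn α β r₁ u))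

/-- Coverage expression when the two nearest distances `r₁`, `r₂` are known. -/
def coverExprTwo (μ α lam P N₀ β r₁ r₂ : ℝ) : ℝ :=
  Real.exp (-(μ * β * N₀ * r₁ ^ α * P⁻¹)) * (1 / (1 + β * (r₁ / r₂) ^ α)) *
    Real.exp (-(2 * Real.pi * lam * ∫ u in Set.Ioi r₂, kernelFn α β r₁ u))

namespace Network

variable {T : ℕ} {Ω : Type*} (N : Network T Ω)

/-- `coverExprOne` for technology `i` at its actual nearest distance. -/
def scoreOne (i : Fin T) (ω : Ω) : ℝ :=
  coverExprOne N.μ N.α (N.intensity i) (N.power i) (N.noise i) (N.threshold i) (N.dist i 0 ω)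

/-- `coverExprTwo` for technology `i` at its actual two nearest distances. -/
def scoreTwo (i : Fin T) (ω : Ω) : ℝ :=
  coverExprTwo N.μ N.α (N.intensity i) (N.power i) (N.noise i) (N.threshold i)
    (N.dist i 0 ω) (N.dist i 1 ω)

end Network

end

end CellularNetwork

open Filter Topology

/-! Fix one technology and let `r 0 ≤ r 1 ≤ …` be its distances. After division by the power and
path loss of the server of rank `j`, coverage says that its fading exceeds `c * r j ^ α` (noise)
plus the sum over `k ≠ j` of `β * (r j / r k) ^ α` times the fading of rank `k`. The exponential
tail turns the conditional probability, given all distances, into a Laplace transform: `exp (-μ c (r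
j) ^ α)` times the product of `1 / (1 + β (r j / r k) ^ α)` over `k ≠ j`
(`measure_inter_forall_requiredFading_le`).

The factors of ranks above `l` are then averaged given the ranks up to `l`. By a strong Markov
property, the points beyond radius `r l` again form a Poisson process, whose Laplace functional
gives `exp (-2πλ ∫ kernelFn)` over `(r l, ∞)` (`lintegral_mul_iInf_prod_attenuation`). As the
process is given only through its counts, this is proved on a grid of radii: `r l` rounded up to the
grid is a discrete stopping time, the rings beyond it have independent Poisson counts with explicit
generating functions, and then the mesh tends to 0 and the outer radius to infinity. Strict ordering
of the distances ensures that rounding loses no point in the limit. The cases `l = 0` and `l = 1`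
are the two formulas.

Optimality has two ingredients. Given all distances, no rank beats rank 0 of the same technology
(`coverGivenDistances_le_zero`); hence every policy has coverage at most the mean score of the
technology that it picks, with equality when it picks nearest stations. Maximizing the score
pointwise is then optimal. Conditional probabilities enter as identities between integrals over
events of the information and become conditional expectations only at the end. -/

namespace CellularNetwork

/-! ### Independence of σ-algebras and completion by null sets. -/

section Independence

variable {Ω : Type*} {m m' : MeasurableSpace Ω} {mΩ : MeasurableSpace Ω} {Pr : Measure Ω}

theorem sup_eq_generateFrom_inter (m₁ m₂ : MeasurableSpace Ω) :
    m₁ ⊔ m₂ = MeasurableSpace.generateFrom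
      {s | ∃ a b, MeasurableSet[m₁] a ∧ MeasurableSet[m₂] b ∧ a ∩ b = s} := by
  refine le_antisymm (sup_le ?_ ?_) (MeasurableSpace.generateFrom_le ?_)
  · intro a ha
    exact MeasurableSpace.measurableSet_generateFrom
      ⟨a, Set.univ, ha, MeasurableSet.univ, Set.inter_univ a⟩
  · intro b hb
    exact MeasurableSpace.measurableSet_generateFrom
      ⟨Set.univ, b, MeasurableSet.univ, hb, Set.univ_inter b⟩
  · rintro _ ⟨a, b, ha, hb, rfl⟩
    exact MeasurableSet.inter ((le_sup_left : m₁ ≤ m₁ ⊔ m₂) a ha)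
      ((le_sup_right : m₂ ≤ m₁ ⊔ m₂) b hb)

theorem isPiSystem_inter (m₁ m₂ : MeasurableSpace Ω) :
    IsPiSystem {s : Set Ω | ∃ a b, MeasurableSet[m₁] a ∧ MeasurableSet[m₂] b ∧ a ∩ b = s} := by
  rintro _ ⟨a, b, ha, hb, rfl⟩ _ ⟨c, d, hc, hd, rfl⟩ -
  exact ⟨a ∩ c, b ∩ d, ha.inter hc, hb.inter hd, Set.inter_inter_inter_comm a c b d⟩

/-- On intersections `a ∩ b ∩ s`, the event `b` of `m₃` splits off first and then `a` separates from
`s`; such intersections form a generating π-system. It serves to add an external source `m₃` to the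
information without losing independence from `m₂`. -/
theorem indep_sup_of_indep [IsProbabilityMeasure Pr] {m₁ m₂ m₃ : MeasurableSpace Ω}
    (h₁ : m₁ ≤ mΩ) (h₂ : m₂ ≤ mΩ) (h₃ : m₃ ≤ mΩ)
    (h₁₂ : Indep m₁ m₂ Pr) (h : Indep (m₁ ⊔ m₂) m₃ Pr) : Indep (m₁ ⊔ m₃) m₂ Pr := by
  refine IndepSets.indep (sup_le h₁ h₃) h₂ (isPiSystem_inter m₁ m₃)
    (@MeasurableSpace.isPiSystem_measurableSet _ m₂) (sup_eq_generateFrom_inter m₁ m₃)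
    (@MeasurableSpace.generateFrom_measurableSet _ m₂).symm ?_
  rw [IndepSets_iff]
  rintro _ s ⟨a, b, ha, hb, rfl⟩ (hs : MeasurableSet[m₂] s)
  rw [Indep_iff] at h h₁₂
  have ha' : MeasurableSet[m₁ ⊔ m₂] a := (le_sup_left : m₁ ≤ m₁ ⊔ m₂) a ha
  have hs' : MeasurableSet[m₁ ⊔ m₂] s := (le_sup_right : m₂ ≤ m₁ ⊔ m₂) s hs
  rw [Set.inter_right_comm, h _ _ (MeasurableSet.inter ha' hs') hb, h _ _ ha' hb, h₁₂ _ _ ha hs]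
  ring

/-- Substitution in an integral over independent sources: the second source may be integrated out
first. -/
theorem lintegral_indep_eq_lintegral_lintegral [IsProbabilityMeasure Pr]
    {E F : Type*} [MeasurableSpace E] [MeasurableSpace F] (hm : m ≤ mΩ)
    {X : Ω → F} (hX : Measurable X) (hind : Indep m (MeasurableSpace.comap X inferInstance) Pr)
    {a : Ω → E} (ha : Measurable[m] a) {f : E → F → ENNReal}
    (hf : Measurable (Function.uncurry f)) :
    ∫⁻ ω, f (a ω) (X ω) ∂Pr = ∫⁻ ω, ∫⁻ x, f (a ω) x ∂(Pr.map X) ∂Pr := by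
  have ha' : Measurable a := ha.mono hm le_rfl
  have hi : IndepFun a X Pr := by
    rw [IndepFun_iff_Indep]
    exact indep_of_indep_of_le_left hind ha.comap_le
  have hprod := (indepFun_iff_map_prod_eq_prod_map_map ha'.aemeasurable hX.aemeasurable).1 hi
  have : IsProbabilityMeasure (Pr.map X) := Measure.isProbabilityMeasure_map hX.aemeasurable
  calc ∫⁻ ω, f (a ω) (X ω) ∂Pr
      = ∫⁻ p, Function.uncurry f p ∂(Pr.map fun ω => (a ω, X ω)) := by
        rw [lintegral_map hf (ha'.prodMk hX)]; rfl
    _ = ∫⁻ y, ∫⁻ x, f y x ∂(Pr.map X) ∂(Pr.map a) := by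
        rw [hprod, lintegral_prod _ hf.aemeasurable]; rfl
    _ = ∫⁻ ω, ∫⁻ x, f (a ω) x ∂(Pr.map X) ∂Pr := by
        rw [lintegral_map _ ha']
        exact hf.lintegral_prod_right'

/-- The events of `mΩ` that agree with an event of `m` up to a null set. -/
@[reducible] def nullExtension (Pr : Measure Ω) (m : MeasurableSpace Ω) : MeasurableSpace Ω :=
  eventuallyMeasurableSpace m (ae Pr) ⊓ mΩ

theorem measurableSet_nullExtension {s t : Set Ω} (hs : MeasurableSet s)
    (ht : MeasurableSet[m] t) (h : s =ᵐ[Pr] t) : MeasurableSet[nullExtension Pr m] s :=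
  MeasurableSpace.measurableSet_inf.2 ⟨⟨t, ht, h⟩, hs⟩

theorem le_nullExtension (hm : m ≤ mΩ) : m ≤ nullExtension Pr m :=
  le_inf (fun s hs => ⟨s, hs, EventuallyEq.refl _ _⟩) hm

theorem nullExtension_mono (h : m ≤ m') :
    nullExtension Pr m ≤ nullExtension Pr m' := by
  refine inf_le_inf_right _ ?_
  rintro s ⟨t, ht, hst⟩
  exact ⟨t, h t ht, hst⟩

theorem indep_nullExtension (h : Indep m m' Pr) :
    Indep (nullExtension Pr m) m' Pr := by
  rw [Indep_iff] at h ⊢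
  intro s t hs ht
  obtain ⟨⟨s', hs', hss⟩, -⟩ := MeasurableSpace.measurableSet_inf.1 hs
  rw [measure_congr hss, ← h s' t hs' ht]
  exact measure_congr (hss.inter (EventuallyEq.refl _ _))

end Independence

/-! ### Poisson and exponential laws. -/

section Laws

theorem lintegral_pow_poissonMeasure (r : NNReal) {z : ℝ} (hz : 0 ≤ z) :
    ∫⁻ n : ℕ, ENNReal.ofReal z ^ n ∂(poissonMeasure r) =
      ENNReal.ofReal (Real.exp (-(r * (1 - z)))) := by
  have h : HasSum (fun n : ℕ => Real.exp (-r) * ((r * z) ^ n / n.factorial))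
      (Real.exp (-r) * Real.exp (r * z)) := by
    refine HasSum.mul_left _ ?_
    rw [Real.exp_eq_exp_ℝ]
    exact NormedSpace.expSeries_div_hasSum_exp (r * z : ℝ)
  rw [lintegral_countable']
  have hterm : ∀ n : ℕ, ENNReal.ofReal z ^ n * poissonMeasure r {n} =
      ENNReal.ofReal (Real.exp (-r) * ((r * z) ^ n / n.factorial)) := by
    intro n
    rw [poissonMeasure_singleton, ← ENNReal.ofReal_pow hz, ← ENNReal.ofReal_mul (by positivity)]
    congr 1
    rw [mul_pow]; ring
  simp_rw [hterm]
  rw [← ENNReal.ofReal_tsum_of_nonneg (fun n => by positivity) h.summable, h.tsum_eq,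
    ← Real.exp_add]
  congr 2; ring

/-- The probability is `1 - (1 + r) exp (-r)`, and `exp (-r) ≥ 1 - r`. The quadratic order in `r` is
what makes a union bound over thin rings vanish. -/
theorem poissonMeasure_two_le (r : NNReal) :
    poissonMeasure r {n | 2 ≤ n} ≤ ENNReal.ofReal ((r : ℝ) ^ 2) := by
  have hc : {n : ℕ | 2 ≤ n} = ({0, 1} : Set ℕ)ᶜ := by
    ext n; simp; omega
  have h01 : (poissonMeasure r).real {0, 1} = Real.exp (-r) + Real.exp (-r) * r := by
    rw [Set.insert_eq, measureReal_union (by simp) (by simp), poissonMeasure_real_singleton,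
      poissonMeasure_real_singleton]
    simp
  rw [← ofReal_measureReal]
  refine ENNReal.ofReal_le_ofReal ?_
  rw [hc, probReal_compl_eq_one_sub (by measurability), h01]
  have h1 : 1 - (r : ℝ) ≤ Real.exp (-r) := Real.one_sub_le_exp_neg r
  have hr : (0 : ℝ) ≤ r := r.2
  nlinarith

theorem tendsto_poissonMeasure_le (k : ℕ) :
    Tendsto (fun r : NNReal => poissonMeasure r {n | n ≤ k}) atTop (𝓝 0) := by
  have hs : ∀ r : NNReal, poissonMeasure r {n | n ≤ k} =
      ∑ n ∈ Finset.range (k + 1), ENNReal.ofReal (Real.exp (-r) * r ^ n / n.factorial) := by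
    intro r
    have : {n : ℕ | n ≤ k} = ↑(Finset.range (k + 1)) := by
      ext n; simp
    rw [this, ← sum_measure_singleton]
    simp [poissonMeasure_singleton]
  simp_rw [hs]
  rw [show (0 : ENNReal) = ∑ n ∈ Finset.range (k + 1), (0 : ENNReal) by simp]
  refine tendsto_finsetSum _ fun n _ => ?_
  rw [← ENNReal.ofReal_zero]
  refine ENNReal.tendsto_ofReal ?_
  have h := (Real.tendsto_pow_mul_exp_neg_atTop_nhds_zero n).div_const (n.factorial : ℝ)
  rw [zero_div] at h
  refine (h.comp (NNReal.tendsto_coe_atTop.2 tendsto_id)).congr fun r => ?_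
  simp [mul_comm]

theorem expMeasure_Ici {μ : ℝ} (hμ : 0 < μ) {x : ℝ} (hx : 0 ≤ x) :
    expMeasure μ (Set.Ici x) = ENNReal.ofReal (Real.exp (-(μ * x))) := by
  have := isProbabilityMeasure_expMeasure hμ
  have hac : expMeasure μ ≪ volume := withDensity_absolutelyContinuous _ _
  have h0 : expMeasure μ (Set.Ici x) = expMeasure μ (Set.Ioi x) :=
    measure_congr (hac.ae_le Ioi_ae_eq_Ici.symm)
  rw [h0, ← ofReal_measureReal, ← Set.compl_Iic, probReal_compl_eq_one_sub measurableSet_Iic,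
    ← cdf_eq_real, cdf_expMeasure_eq hμ, if_pos hx]
  congr 1; ring

theorem expMeasure_Iic_zero {μ : ℝ} (hμ : 0 < μ) : expMeasure μ (Set.Iic 0) = 0 := by
  have := isProbabilityMeasure_expMeasure hμ
  rw [← ofReal_measureReal, ← cdf_eq_real, cdf_expMeasure_eq hμ]
  simp

theorem lintegral_exp_neg_expMeasure {μ : ℝ} (hμ : 0 < μ) {a : ℝ} (ha : 0 ≤ a) :
    ∫⁻ x, ENNReal.ofReal (Real.exp (-(a * x))) ∂(expMeasure μ) =
      ENNReal.ofReal (μ / (μ + a)) := by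
  have hpos : 0 < μ + a := by linarith
  have h1 : ∫⁻ x, ENNReal.ofReal (Real.exp (-(a * x))) ∂(expMeasure μ) =
      ∫⁻ x, ENNReal.ofReal (μ / (μ + a)) * exponentialPDF (μ + a) x := by
    have hd : expMeasure μ = volume.withDensity (exponentialPDF μ) := rfl
    have hmeas : Measurable (exponentialPDF μ) :=
      (measurable_exponentialPDFReal μ).ennreal_ofReal
    rw [hd, lintegral_withDensity_eq_lintegral_mul _ hmeas (by fun_prop)]
    refine lintegral_congr fun x => ?_
    rw [Pi.mul_apply]
    rcases lt_or_ge x 0 with hx | hx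
    · rw [exponentialPDF_of_neg hx, exponentialPDF_of_neg hx, zero_mul, mul_zero]
    · rw [exponentialPDF_of_nonneg hx, exponentialPDF_of_nonneg hx,
        ← ENNReal.ofReal_mul (by positivity), ← ENNReal.ofReal_mul (by positivity)]
      congr 1
      rw [mul_assoc, ← Real.exp_add, ← mul_assoc, div_mul_cancel₀ _ hpos.ne']
      congr 2; ring
  rw [h1, lintegral_const_mul _ (show Measurable (exponentialPDF (μ + a)) from
      (measurable_exponentialPDFReal _).ennreal_ofReal), lintegral_exponentialPDF_eq_one hpos, mul_one]

end Laws

/-- The σ-algebra generated by the counts of `φ` in Borel subsets of `C`. -/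
@[reducible] noncomputable def restrictSigma {Ω : Type*} (φ : Ω → Set Plane) (C : Set Plane) :
    MeasurableSpace Ω :=
  ⨆ B : {B : Set Plane // MeasurableSet B ∧ B ⊆ C}, MeasurableSpace.comap (pointCount φ B) ⊤

/-- The half-open ring `{x | a < |x| ≤ b}` around the origin. -/
def ring (a b : ℝ) : Set Plane := Metric.closedBall 0 b \ Metric.closedBall 0 a

theorem measurableSet_ring (a b : ℝ) : MeasurableSet (ring a b) :=
  measurableSet_closedBall.diff measurableSet_closedBall

theorem encard_closedBall_eq_add_ring (S : Set Plane) {a b : ℝ} (hab : a ≤ b) :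
    (S ∩ Metric.closedBall 0 b).encard =
      (S ∩ Metric.closedBall 0 a).encard + (S ∩ ring a b).encard := by
  rw [← Set.encard_union_eq]
  · congr 1
    rw [← Set.inter_union_distrib_left, ring, Set.union_sdiff_cancel
      (Metric.closedBall_subset_closedBall hab)]
  · exact (Set.disjoint_sdiff_right).mono Set.inter_subset_right Set.inter_subset_right

/-! ### Ranked distances of a fixed locally finite set. -/

section Deterministic

variable {S : Set Plane}

/-- `S` is infinite and has finitely many points in every bounded set. -/
structure IsLocallyFiniteInfinite (S : Set Plane) : Prop where
  finite : ∀ n : ℕ, (S ∩ Metric.closedBall 0 (n : ℝ)).Finite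
  infinite : ∀ k : ℕ, ∃ n : ℕ, (k : ℕ∞) < (S ∩ Metric.closedBall 0 (n : ℝ)).encard

/-- The number of points of `S` at distance at most `t` from the origin. -/
noncomputable def ballCount (S : Set Plane) (t : ℝ) : ℕ :=
  (S ∩ Metric.closedBall 0 t).encard.toNat

theorem nthDist_nonneg (S : Set Plane) (k : ℕ) : 0 ≤ nthDist S k :=
  Real.sInf_nonneg fun _ h => h.1

theorem encard_closedBall_mono (S : Set Plane) {a b : ℝ} (hab : a ≤ b) :
    (S ∩ Metric.closedBall 0 a).encard ≤ (S ∩ Metric.closedBall 0 b).encard :=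
  Set.encard_le_encard (Set.inter_subset_inter_right _ (Metric.closedBall_subset_closedBall hab))

theorem IsLocallyFiniteInfinite.finite_closedBall (hS : IsLocallyFiniteInfinite S) (t : ℝ) :
    (S ∩ Metric.closedBall 0 t).Finite := by
  obtain ⟨n, hn⟩ := exists_nat_ge t
  exact (hS.finite n).subset
    (Set.inter_subset_inter_right _ (Metric.closedBall_subset_closedBall hn))

/-- The infimum in `nthDist` is attained: by local finiteness there is a gap without points just
beyond radius `t`, so a slightly larger ball has the same points. This translates distances into
counts. -/
theorem IsLocallyFiniteInfinite.lt_encard_iff (hS : IsLocallyFiniteInfinite S) {t : ℝ}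
    (ht : 0 ≤ t) (k : ℕ) :
    (k : ℕ∞) < (S ∩ Metric.closedBall 0 t).encard ↔ nthDist S k ≤ t := by
  refine ⟨fun h => csInf_le ⟨0, fun _ h => h.1⟩ ⟨ht, h⟩, fun h => ?_⟩
  have hfin : (((fun x : Plane => ‖x‖) '' (S ∩ Metric.closedBall 0 (t + 1))) ∩ Set.Ioi t).Finite :=
    ((hS.finite_closedBall (t + 1)).image _).subset Set.inter_subset_left
  obtain ⟨ε, hε, hε1, hεs⟩ : ∃ ε : ℝ, 0 < ε ∧ ε ≤ 1 ∧
      ∀ x ∈ S, ‖x‖ < t + ε → ‖x‖ ≤ t := by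
    have hev : ∀ᶠ u in 𝓝[>] t, ∀ y ∈ (((fun x : Plane => ‖x‖) ''
        (S ∩ Metric.closedBall 0 (t + 1))) ∩ Set.Ioi t), u < y := by
      rw [hfin.eventually_all]
      exact fun y hy => Filter.mem_of_superset (Ioo_mem_nhdsGT hy.2) fun u hu => hu.2
    have hev2 : ∀ᶠ u in 𝓝[>] t, u ∈ Set.Ioc t (t + 1) := Ioc_mem_nhdsGT (by linarith)
    obtain ⟨u, hu, hu2⟩ := (hev.and hev2).exists
    refine ⟨u - t, by linarith [hu2.1], by linarith [hu2.2], fun x hx hxu => ?_⟩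
    by_contra hlt
    have := hu ‖x‖ ⟨⟨x, ⟨hx, by
      rw [mem_closedBall_zero_iff]; linarith [hu2.2]⟩, rfl⟩, not_le.1 hlt⟩
    linarith
  have hne : {ρ : ℝ | 0 ≤ ρ ∧ (k : ℕ∞) < (S ∩ Metric.closedBall 0 ρ).encard}.Nonempty := by
    obtain ⟨n, hn⟩ := hS.infinite k
    exact ⟨n, n.cast_nonneg, hn⟩
  obtain ⟨ρ, ⟨hρ0, hρ⟩, hρt⟩ := exists_lt_of_csInf_lt hne (lt_of_le_of_lt h (lt_add_of_pos_right t hε))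
  refine hρ.trans_le (Set.encard_le_encard ?_)
  rintro x ⟨hx, hxρ⟩
  refine ⟨hx, ?_⟩
  rw [mem_closedBall_zero_iff] at hxρ ⊢
  exact hεs x hx (by linarith)

theorem IsLocallyFiniteInfinite.coe_ballCount (hS : IsLocallyFiniteInfinite S) (t : ℝ) :
    (ballCount S t : ℕ∞) = (S ∩ Metric.closedBall 0 t).encard :=
  ENat.natCast_toNat (hS.finite_closedBall t).encard_lt_top.ne

theorem IsLocallyFiniteInfinite.lt_ballCount_iff (hS : IsLocallyFiniteInfinite S) {t : ℝ}
    (ht : 0 ≤ t) {k : ℕ} : k < ballCount S t ↔ nthDist S k ≤ t := by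
  rw [← hS.lt_encard_iff ht, ← hS.coe_ballCount, Nat.cast_lt]

theorem IsLocallyFiniteInfinite.monotone_nthDist (hS : IsLocallyFiniteInfinite S) :
    Monotone (nthDist S) := by
  intro j k hjk
  rw [← hS.lt_ballCount_iff (nthDist_nonneg S k)]
  exact hjk.trans_lt ((hS.lt_ballCount_iff (nthDist_nonneg S k)).2 le_rfl)

theorem ballCount_mono (hS : IsLocallyFiniteInfinite S) : Monotone (ballCount S) := by
  intro a b hab
  have := encard_closedBall_mono S hab
  rwa [← hS.coe_ballCount, ← hS.coe_ballCount, Nat.cast_le] at this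

theorem IsLocallyFiniteInfinite.ring_count (hS : IsLocallyFiniteInfinite S) {a b : ℝ}
    (hab : a ≤ b) : (S ∩ ring a b).encard.toNat = ballCount S b - ballCount S a := by
  have h := encard_closedBall_eq_add_ring S hab
  have hfin : (S ∩ ring a b).encard ≠ ⊤ := ((hS.finite_closedBall b).subset
    (Set.inter_subset_inter_right _ Set.sdiff_subset)).encard_lt_top.ne
  rw [← hS.coe_ballCount, ← hS.coe_ballCount, ← ENat.natCast_toNat hfin, ← Nat.cast_add,
    Nat.cast_inj] at h
  omega

theorem IsLocallyFiniteInfinite.nthDist_pos (hS : IsLocallyFiniteInfinite S)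
    (h0 : (S ∩ Metric.closedBall 0 0).encard = 0) (k : ℕ) : 0 < nthDist S k := by
  by_contra h
  have := (hS.lt_encard_iff le_rfl k).2 (not_lt.1 h)
  rw [h0] at this
  exact not_lt_bot this

/-- On arbitrarily fine grids of radii, no two points of `S` lie in the same ring. -/
def IsRadiallySimple (S : Set Plane) : Prop :=
  ∀ R : ℕ, ∃ n : ℕ, ∀ j < R * (n + 1),
    (S ∩ ring ((j : ℝ) / (n + 1)) ((j + 1 : ℝ) / (n + 1))).encard < 2

/-- If ranks `k` and `k + 1` had the same distance `t`, the grid ring containing `t` would hold two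
points for every mesh, against radial simplicity. -/
theorem IsLocallyFiniteInfinite.strictMono_nthDist (hS : IsLocallyFiniteInfinite S)
    (h0 : (S ∩ Metric.closedBall 0 0).encard = 0) (hs : IsRadiallySimple S) :
    StrictMono (nthDist S) := by
  refine strictMono_nat_of_lt_succ fun k => ?_
  by_contra! hle
  set t := nthDist S k with ht
  have htpos : 0 < t := hS.nthDist_pos h0 k
  obtain ⟨n, hn⟩ := hs ⌈t⌉₊
  have hn1 : (0 : ℝ) < n + 1 := by positivity
  -- The rings are open on the inside, so the origin lies in none of them; positivity of `t`
  -- provides the index `j` of the ring around `t`.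
  have hcpos : 0 < ⌈t * (n + 1)⌉₊ := Nat.ceil_pos.2 (by positivity)
  obtain ⟨j, hj⟩ : ∃ j, ⌈t * (n + 1)⌉₊ = j + 1 := ⟨⌈t * (n + 1)⌉₊ - 1, by omega⟩
  have hlo : (j : ℝ) / (n + 1) < t := by
    rw [div_lt_iff₀ hn1]
    exact Nat.lt_ceil.1 (by omega)
  have hhi : t ≤ (j + 1 : ℝ) / (n + 1) := by
    rw [le_div_iff₀ hn1]
    have := Nat.le_ceil (t * ((n : ℝ) + 1))
    rw [hj] at this
    exact_mod_cast this
  have hjR : j < ⌈t⌉₊ * (n + 1) := by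
    have : ⌈t * (n + 1)⌉₊ ≤ ⌈t⌉₊ * (n + 1) := by
      rw [Nat.ceil_le]
      push_cast
      exact mul_le_mul_of_nonneg_right (Nat.le_ceil t) hn1.le
    omega
  have hring := hn j hjR
  have hsum := encard_closedBall_eq_add_ring S (hlo.le.trans hhi)
  have h1 : ¬ k < ballCount S ((j : ℝ) / (n + 1)) := by
    rw [hS.lt_ballCount_iff (by positivity)]
    exact not_le.2 hlo
  have h2 : k + 1 < ballCount S ((j + 1 : ℝ) / (n + 1)) := by
    rw [hS.lt_ballCount_iff (by positivity)]
    exact hle.trans hhi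
  have hfin : (S ∩ ring ((j : ℝ) / (n + 1)) ((j + 1 : ℝ) / (n + 1))).encard ≠ ⊤ :=
    ne_top_of_lt hring
  rw [← hS.coe_ballCount, ← hS.coe_ballCount, ← ENat.natCast_toNat hfin, ← Nat.cast_add,
    Nat.cast_inj] at hsum
  rw [← ENat.natCast_toNat hfin] at hring
  have hring' : (S ∩ ring ((j : ℝ) / (n + 1)) ((j + 1 : ℝ) / (n + 1))).encard.toNat < 2 := by
    exact_mod_cast hring
  omega

end Deterministic

/-! ### Measurability of distances and independence over disjoint regions. -/

section PointProcess

variable {Ω : Type*} {mΩ : MeasurableSpace Ω} {Pr : Measure Ω} {φ : Ω → Set Plane} {lam : ℝ}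

theorem pointSigma_le (h : IsPoissonPointProcess Pr φ lam) : pointSigma φ ≤ mΩ :=
  iSup₂_le fun B hB => (h.measurable_count B hB).comap_le

theorem restrictSigma_le_pointSigma (φ : Ω → Set Plane) (C : Set Plane) :
    restrictSigma φ C ≤ pointSigma φ :=
  iSup_le fun B => le_iSup₂_of_le B.1 B.2.1 le_rfl

theorem restrictSigma_mono (φ : Ω → Set Plane) {C D : Set Plane} (h : C ⊆ D) :
    restrictSigma φ C ≤ restrictSigma φ D :=
  iSup_le fun B => le_iSup_of_le (⟨B.1, B.2.1, B.2.2.trans h⟩ :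
    {B : Set Plane // MeasurableSet B ∧ B ⊆ D}) le_rfl

theorem measurable_pointCount_restrictSigma (φ : Ω → Set Plane) {B C : Set Plane}
    (hB : MeasurableSet B) (hBC : B ⊆ C) : Measurable[restrictSigma φ C] (pointCount φ B) :=
  measurable_iff_comap_le.2 (le_iSup_of_le (⟨B, hB, hBC⟩ :
    {B : Set Plane // MeasurableSet B ∧ B ⊆ C}) le_rfl)

theorem measurable_pointCount_pointSigma (φ : Ω → Set Plane) {B : Set Plane}
    (hB : MeasurableSet B) : Measurable[pointSigma φ] (pointCount φ B) :=
  measurable_iff_comap_le.2 (le_iSup₂_of_le B hB le_rfl)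

theorem measurable_nthDist (φ : Ω → Set Plane) (k : ℕ) :
    Measurable[pointSigma φ] fun ω => nthDist (φ ω) k := by
  have hmeas : ∀ r : ℝ, MeasurableSet[pointSigma φ]
      {ω | (k : ℕ∞) < (φ ω ∩ Metric.closedBall 0 r).encard} := fun r =>
    measurable_pointCount_pointSigma φ (measurableSet_closedBall (x := 0) (ε := r))
      (MeasurableSet.of_discrete (s := Set.Ioi (k : ℕ∞)))
  let _ : MeasurableSpace Ω := pointSigma φ
  refine measurable_of_Iio fun u => ?_
  rcases le_or_gt u 0 with hu | hu
  · have : (fun ω => nthDist (φ ω) k) ⁻¹' Set.Iio u = ∅ := by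
      ext ω
      simpa using hu.trans (nthDist_nonneg _ _)
    rw [this]
    exact MeasurableSet.empty
  -- The last set collects the samples with at most `k` points, for which the infimum of the empty
  -- set is 0. The identity holds for every `ω`, so no null set enters.
  · have : (fun ω => nthDist (φ ω) k) ⁻¹' Set.Iio u =
        (⋃ q : {q : ℚ // (0 : ℝ) ≤ q ∧ (q : ℝ) < u},
          {ω | (k : ℕ∞) < (φ ω ∩ Metric.closedBall 0 (q.1 : ℝ)).encard}) ∪
        (⋃ n : ℕ, {ω | (k : ℕ∞) < (φ ω ∩ Metric.closedBall 0 (n : ℝ)).encard})ᶜ := by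
      ext ω
      simp only [Set.mem_preimage, Set.mem_Iio, Set.mem_union, Set.mem_iUnion, Set.mem_ofPred_eq,
        Set.mem_compl_iff, Subtype.exists, exists_prop]
      constructor
      · intro h
        by_cases hne : {ρ : ℝ | 0 ≤ ρ ∧
            (k : ℕ∞) < (φ ω ∩ Metric.closedBall 0 ρ).encard}.Nonempty
        · obtain ⟨ρ, ⟨hρ0, hρ⟩, hρu⟩ := exists_lt_of_csInf_lt hne h
          obtain ⟨q, hq1, hq2⟩ := exists_rat_btwn hρu
          exact Or.inl ⟨q, ⟨hρ0.trans hq1.le, hq2⟩,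
            hρ.trans_le (encard_closedBall_mono _ hq1.le)⟩
        · refine Or.inr ?_
          rintro ⟨n, hn⟩
          exact hne ⟨n, n.cast_nonneg, hn⟩
      · rintro (⟨q, ⟨hq0, hqu⟩, hq⟩ | hnot)
        · exact lt_of_le_of_lt (csInf_le ⟨0, fun _ h => h.1⟩ ⟨hq0, hq⟩) hqu
        · have he : {ρ : ℝ | 0 ≤ ρ ∧ (k : ℕ∞) < (φ ω ∩ Metric.closedBall 0 ρ).encard} = ∅ := by
            refine Set.eq_empty_of_forall_notMem fun ρ hρ => hnot ?_
            obtain ⟨n, hn⟩ := exists_nat_ge ρ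
            exact ⟨n, hρ.2.trans_le (encard_closedBall_mono _ hn)⟩
          rw [nthDist, he, Real.sInf_empty]
          exact hu
    rw [this]
    exact (MeasurableSet.iUnion fun q => hmeas _).union (MeasurableSet.iUnion fun n => hmeas _).compl

/-- The restrictions of a Poisson process to disjoint sets are independent. -/
theorem indep_restrictSigma_pointCount [IsProbabilityMeasure Pr]
    (h : IsPoissonPointProcess Pr φ lam) {C I : Set Plane} (hC : MeasurableSet C)
    (hI : MeasurableSet I) (hCI : Disjoint C I) :
    Indep (restrictSigma φ C) (MeasurableSpace.comap (pointCount φ I) ⊤) Pr := by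
  classical
  let ι := {B : Set Plane // MeasurableSet B ∧ B ⊆ C}
  let m : Finset ι → MeasurableSpace Ω :=
    fun s => ⨆ B ∈ s, MeasurableSpace.comap (pointCount φ B.1) ⊤
  -- Independence is given only for finitely many disjoint sets, while the generators of
  -- `restrictSigma` may overlap. A directed union reduces the claim to a finite family `s`, and the
  -- atoms of the partition of `C` generated by `s` are disjoint.
  have hle : ∀ s, m s ≤ mΩ := fun s =>
    iSup₂_le fun B _ => (h.measurable_count B.1 B.2.1).comap_le
  have hsup : restrictSigma φ C ≤ ⨆ s, m s := by
    refine iSup_le fun B => le_iSup_of_le {B} ?_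
    simp [m]
  have hmono : Monotone m := fun s t hst => biSup_mono fun B hB => hst hB
  refine indep_of_indep_of_le_left (indep_iSup_of_directed_le (m := m) (fun s => ?_) hle
    (h.measurable_count I hI).comap_le hmono.directed_le) hsup
  let atom : (s → Bool) → Set Plane := fun a => C ∩ ⋂ b : s, {x | x ∈ b.1.1 ↔ a b = true}
  have hatom_meas : ∀ a, MeasurableSet (atom a) := by
    intro a
    refine hC.inter (MeasurableSet.iInter fun b => ?_)
    by_cases hab : a b = true
    · have : {x | x ∈ b.1.1 ↔ a b = true} = b.1.1 := by ext; simp [hab]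
      rw [this]
      exact b.1.2.1
    · have : {x | x ∈ b.1.1 ↔ a b = true} = b.1.1ᶜ := by ext; simp [hab]
      rw [this]
      exact b.1.2.1.compl
  have hatom_disj : Pairwise fun a a' => Disjoint (atom a) (atom a') := by
    intro a a' haa
    rw [Set.disjoint_left]
    rintro x ⟨-, hx⟩ ⟨-, hx'⟩
    refine haa (funext fun b => ?_)
    rw [Set.mem_iInter] at hx hx'
    have h1 : x ∈ b.1.1 ↔ a b = true := hx b
    have h2 : x ∈ b.1.1 ↔ a' b = true := hx' b
    exact Bool.eq_iff_iff.2 (h1.symm.trans h2)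
  let D : Option (s → Bool) → Set Plane := fun o => o.elim I atom
  have hD_meas : ∀ o, MeasurableSet (D o) := by
    rintro (_ | a)
    · exact hI
    · exact hatom_meas a
  have hD_disj : Pairwise fun o o' => Disjoint (D o) (D o') := by
    rintro (_ | a) (_ | a') hoo
    · exact absurd rfl hoo
    · exact (hCI.mono_left Set.inter_subset_left).symm
    · exact hCI.mono_left Set.inter_subset_left
    · exact hatom_disj fun haa => hoo (by rw [haa])
  let e := (Fintype.equivFin (Option (s → Bool))).symm
  have hind : iIndepFun (fun o => pointCount φ (D o)) Pr := by
    refine iIndepFun.of_precomp (g := e) e.surjective ?_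
    exact h.indep_count _ (fun k => D (e k)) (fun k => hD_meas _)
      fun k l hkl => hD_disj fun hh => hkl (e.injective hh)
  have hind2 := indep_iSup_of_disjoint
    (m := fun o => MeasurableSpace.comap (pointCount φ (D o)) ⊤)
    (fun o => (h.measurable_count _ (hD_meas o)).comap_le) hind.iIndep
    (S := {none}ᶜ) (T := {none}) (disjoint_compl_left)
  refine indep_of_indep_of_le hind2 (iSup₂_le fun B hB => ?_) ?_
  · rw [← measurable_iff_comap_le]
    have hunion : B.1 = ⋃ a : {a : s → Bool // a ⟨B, hB⟩ = true}, atom a.1 := by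
      ext x
      simp only [Set.mem_iUnion]
      constructor
      · intro hx
        refine ⟨⟨fun b => decide (x ∈ b.1.1), by simpa using hx⟩, B.2.2 hx, ?_⟩
        simp
      · rintro ⟨a, -, hx⟩
        rw [Set.mem_iInter] at hx
        exact (hx ⟨B, hB⟩).2 a.2
    -- Each set of the family is the disjoint union of its atoms, so its count is a sum of atom
    -- counts.
    have hcount : pointCount φ B.1 = fun ω => ∑ a : {a : s → Bool // a ⟨B, hB⟩ = true},
        pointCount φ (atom a.1) ω := by
      funext ω
      simp only [pointCount]
      conv_lhs => rw [hunion, Set.inter_iUnion]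
      rw [Set.encard_iUnion_of_finite, finsum_eq_sum_of_fintype]
      intro a a' haa
      exact (hatom_disj fun hh => haa (Subtype.ext hh)).mono
        Set.inter_subset_right Set.inter_subset_right
    rw [hcount]
    refine Finset.measurable_fun_sum _ fun a _ => ?_
    rw [measurable_iff_comap_le]
    exact le_iSup₂_of_le (some a.1) (by simp) le_rfl
  · exact le_iSup₂_of_le none rfl le_rfl

end PointProcess

/-! ### Almost sure properties of a Poisson sample. -/

section AlmostSure

variable {Ω : Type*} {mΩ : MeasurableSpace Ω} {Pr : Measure Ω} {φ : Ω → Set Plane} {lam : ℝ}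

theorem volume_real_ring {a b : ℝ} (ha : 0 ≤ a) (hab : a ≤ b) :
    volume.real (ring a b) = Real.pi * (b ^ 2 - a ^ 2) := by
  have hball : ∀ r : ℝ, 0 ≤ r →
      volume.real (Metric.closedBall (0 : Plane) r) = Real.pi * r ^ 2 := by
    intro r hr
    rw [measureReal_def, EuclideanSpace.volume_closedBall_fin_two, ENNReal.toReal_mul,
      ENNReal.toReal_pow, ENNReal.toReal_ofReal hr, ENNReal.toReal_ofReal Real.pi_nonneg, mul_comm]
  rw [ring, measureReal_sdiff (Metric.closedBall_subset_closedBall hab) measurableSet_closedBall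
    measure_closedBall_lt_top.ne, hball a ha, hball b (ha.trans hab)]
  ring

theorem volume_ring_ne_top (a b : ℝ) : volume (ring a b) ≠ ⊤ :=
  (measure_mono_top Set.sdiff_subset).mt measure_closedBall_lt_top.ne

theorem IsPoissonPointProcess.law_toNat (h : IsPoissonPointProcess Pr φ lam) {B : Set Plane}
    (hB : MeasurableSet B) (hfin : volume B ≠ ⊤) :
    Pr.map (fun ω => (pointCount φ B ω).toNat) =
      poissonMeasure (Real.toNNReal (lam * volume.real B)) := by
  have h1 : (fun ω => (pointCount φ B ω).toNat) = ENat.toNat ∘ pointCount φ B := rfl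
  rw [h1, ← Measure.map_map (by fun_prop) (h.measurable_count B hB), h.law_count B hB hfin,
    Measure.map_map (by fun_prop) (by fun_prop)]
  exact Measure.map_id

theorem IsPoissonPointProcess.measure_count (h : IsPoissonPointProcess Pr φ lam) {B : Set Plane}
    (hB : MeasurableSet B) (hfin : volume B ≠ ⊤) (s : Set ℕ∞) :
    Pr {ω | pointCount φ B ω ∈ s} =
      poissonMeasure (Real.toNNReal (lam * volume.real B)) {n | (n : ℕ∞) ∈ s} := by
  have h1 : Pr {ω | pointCount φ B ω ∈ s} = Pr.map (pointCount φ B) s :=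
    (Measure.map_apply (h.measurable_count B hB) (MeasurableSet.of_discrete)).symm
  rw [h1, h.law_count B hB hfin, Measure.map_apply (by fun_prop) (MeasurableSet.of_discrete)]
  rfl

theorem ae_isLocallyFiniteInfinite (h : IsPoissonPointProcess Pr φ lam) (hlam : 0 < lam) :
    ∀ᵐ ω ∂Pr, IsLocallyFiniteInfinite (φ ω) := by
  have hfin : ∀ᵐ ω ∂Pr, ∀ n : ℕ, (φ ω ∩ Metric.closedBall 0 (n : ℝ)).Finite := by
    rw [ae_all_iff]
    intro n
    have h0 := h.measure_count (measurableSet_closedBall (x := 0) (ε := (n : ℝ)))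
      measure_closedBall_lt_top.ne {⊤}
    have hempty : {m : ℕ | (m : ℕ∞) ∈ ({⊤} : Set ℕ∞)} = ∅ := by ext m; simp
    rw [hempty, measure_empty] at h0
    rw [ae_iff]
    convert! h0 using 3 with ω
    simp [pointCount, Set.encard_eq_top_iff]
  have hinf : ∀ᵐ ω ∂Pr, ∀ k : ℕ, ∃ n : ℕ,
      (k : ℕ∞) < (φ ω ∩ Metric.closedBall 0 (n : ℝ)).encard := by
    rw [ae_all_iff]
    intro k
    rw [ae_iff]
    have hr : Tendsto (fun n : ℕ => Real.toNNReal
        (lam * volume.real (Metric.closedBall (0 : Plane) (n : ℝ)))) atTop atTop := by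
      refine tendsto_real_toNNReal_atTop.comp (Tendsto.const_mul_atTop hlam ?_)
      have : ∀ n : ℕ, volume.real (Metric.closedBall (0 : Plane) (n : ℝ)) = Real.pi * (n : ℝ) ^ 2 :=
        fun n => by
          rw [measureReal_def, EuclideanSpace.volume_closedBall_fin_two, ENNReal.toReal_mul,
            ENNReal.toReal_pow, ENNReal.toReal_ofReal (by positivity),
            ENNReal.toReal_ofReal Real.pi_nonneg, mul_comm]
      simp_rw [this]
      exact Tendsto.const_mul_atTop Real.pi_pos
        ((tendsto_pow_atTop two_ne_zero).comp tendsto_natCast_atTop_atTop)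
    refine le_antisymm (ge_of_tendsto' ((tendsto_poissonMeasure_le k).comp hr) fun n => ?_) bot_le
    have h0 := h.measure_count (measurableSet_closedBall (x := 0) (ε := (n : ℝ)))
      measure_closedBall_lt_top.ne (Set.Iic (k : ℕ∞))
    simp only [Set.mem_Iic, Nat.cast_le] at h0
    rw [Function.comp_apply, ← h0]
    refine measure_mono fun ω hω => ?_
    simp only [Set.mem_ofPred_eq, not_exists, not_lt] at hω
    exact hω n
  filter_upwards [hfin, hinf] with ω h1 h2
  exact ⟨h1, h2⟩

theorem ae_encard_zero (h : IsPoissonPointProcess Pr φ lam) :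
    ∀ᵐ ω ∂Pr, (φ ω ∩ Metric.closedBall 0 0).encard = 0 := by
  have h0 := h.measure_count (measurableSet_closedBall (x := 0) (ε := (0 : ℝ)))
    measure_closedBall_lt_top.ne {0}ᶜ
  have hv : volume.real (Metric.closedBall (0 : Plane) 0) = 0 := by simp [measureReal_def]
  have hset : {n : ℕ | (n : ℕ∞) ∈ ({0}ᶜ : Set ℕ∞)} = ({0} : Set ℕ)ᶜ := by
    ext n; simp
  rw [hv, mul_zero, Real.toNNReal_zero, hset, prob_compl_eq_one_sub (measurableSet_singleton 0),
    poissonMeasure_singleton] at h0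
  rw [ae_iff]
  simpa [pointCount] using h0

/-- With mesh `1 / (n + 1)` there are `R (n + 1)` rings, each holding two points with probability at
most `(c / (n + 1)) ^ 2`. The union bound is of order `1 / (n + 1)`. Failure means failure at every
mesh, so letting `n` tend to infinity suffices, without summability. -/
theorem ae_isRadiallySimple (h : IsPoissonPointProcess Pr φ lam) (hlam : 0 < lam) :
    ∀ᵐ ω ∂Pr, IsRadiallySimple (φ ω) := by
  refine ae_all_iff.2 fun R => ?_
  rw [ae_iff]
  -- The ring of index `j` has area `π (2j + 1) / (n + 1) ^ 2`, and `2j + 1 ≤ 2R (n + 1)`; so its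
  -- mean count is at most `c / (n + 1)`.
  set c : ℝ := lam * Real.pi * (2 * R) with hc
  have hc0 : 0 ≤ c := by positivity
  have hbound : ∀ n : ℕ, Pr {ω | ¬ ∃ n : ℕ, ∀ j < R * (n + 1),
      (φ ω ∩ ring ((j : ℝ) / (n + 1)) ((j + 1 : ℝ) / (n + 1))).encard < 2} ≤
      ENNReal.ofReal (R * c ^ 2 * (1 / ((n : ℝ) + 1))) := by
    intro n
    have hn1 : (0 : ℝ) < n + 1 := by positivity
    have hone : ∀ j ∈ Finset.range (R * (n + 1)),
        Pr {ω | 2 ≤ pointCount φ (ring ((j : ℝ) / (n + 1)) ((j + 1 : ℝ) / (n + 1))) ω} ≤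
          ENNReal.ofReal (c ^ 2 * (1 / ((n : ℝ) + 1)) ^ 2) := by
      intro j hj
      have hm := h.measure_count (measurableSet_ring ((j : ℝ) / (n + 1)) ((j + 1 : ℝ) / (n + 1)))
        (volume_ring_ne_top _ _) (Set.Ici 2)
      have hset : {m : ℕ | (m : ℕ∞) ∈ Set.Ici (2 : ℕ∞)} = {m | 2 ≤ m} := by
        ext m
        simp only [Set.mem_Ici, Set.mem_ofPred_eq]
        exact_mod_cast Iff.rfl
      rw [hset] at hm
      refine hm.le.trans ((poissonMeasure_two_le _).trans (ENNReal.ofReal_le_ofReal ?_))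
      have hle : (j : ℝ) / (n + 1) ≤ (j + 1 : ℝ) / (n + 1) := by gcongr; linarith
      rw [volume_real_ring (by positivity) hle, ← mul_pow]
      have hsub : ((j + 1 : ℝ) / (n + 1)) ^ 2 - ((j : ℝ) / (n + 1)) ^ 2 =
          (2 * j + 1) / (n + 1) * (1 / (n + 1)) := by field_simp; ring
      have hjR : (2 * j + 1 : ℝ) / (n + 1) ≤ 2 * R := by
        rw [div_le_iff₀ hn1]
        have : j + 1 ≤ R * (n + 1) := Finset.mem_range.1 hj
        have : (j + 1 : ℝ) ≤ R * (n + 1) := by exact_mod_cast this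
        linarith
      rw [hsub, Real.coe_toNNReal _ (by positivity)]
      refine pow_le_pow_left₀ (by positivity) ?_ 2
      rw [hc]
      calc lam * (Real.pi * ((2 * j + 1) / (n + 1) * (1 / (n + 1))))
          = lam * Real.pi * ((2 * j + 1) / (n + 1)) * (1 / (n + 1)) := by ring
        _ ≤ lam * Real.pi * (2 * R) * (1 / (n + 1)) := by gcongr
    calc _ ≤ Pr (⋃ j ∈ Finset.range (R * (n + 1)),
          {ω | 2 ≤ pointCount φ (ring ((j : ℝ) / (n + 1)) ((j + 1 : ℝ) / (n + 1))) ω}) := by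
          refine measure_mono fun ω hω => ?_
          simp only [Set.mem_ofPred_eq, not_exists, not_forall, not_lt] at hω
          obtain ⟨j, hj, hj2⟩ := hω n
          simp only [Set.mem_iUnion]
          exact ⟨j, Finset.mem_range.2 hj, hj2⟩
      _ ≤ ∑ j ∈ Finset.range (R * (n + 1)),
          Pr {ω | 2 ≤ pointCount φ (ring ((j : ℝ) / (n + 1)) ((j + 1 : ℝ) / (n + 1))) ω} :=
          measure_biUnion_finset_le _ _
      _ ≤ ∑ _j ∈ Finset.range (R * (n + 1)),
          ENNReal.ofReal (c ^ 2 * (1 / ((n : ℝ) + 1)) ^ 2) := Finset.sum_le_sum hone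
      _ = _ := by
          rw [Finset.sum_const, Finset.card_range, nsmul_eq_mul, ← ENNReal.ofReal_natCast,
            ← ENNReal.ofReal_mul (by positivity)]
          congr 1
          push_cast
          field_simp
  have hlim : Tendsto (fun n : ℕ => ENNReal.ofReal (R * c ^ 2 * (1 / ((n : ℝ) + 1)))) atTop
      (𝓝 0) := by
    rw [← ENNReal.ofReal_zero]
    refine ENNReal.tendsto_ofReal ?_
    simpa using (tendsto_one_div_add_atTop_nhds_zero_nat (𝕜 := ℝ)).const_mul (R * c ^ 2)
  exact le_antisymm (ge_of_tendsto' hlim hbound) bot_le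

end AlmostSure

/-- Laplace transform of the fading of an interferer at distance `u`, relative to a server at
distance `s`. -/
noncomputable def attenuation (α β s u : ℝ) : ℝ := 1 / (1 + β * (s / u) ^ α)

/-! ### The factor contributed by one interferer, and its integrability. -/

section Attenuation

variable {α β s u : ℝ}

theorem attenuation_nonneg (hβ : 0 < β) (hs : 0 ≤ s) (hu : 0 ≤ u) : 0 ≤ attenuation α β s u := by
  have := Real.rpow_nonneg (div_nonneg hs hu) α
  unfold attenuation
  positivity

theorem attenuation_le_one (hβ : 0 < β) (hs : 0 ≤ s) (hu : 0 ≤ u) :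
    attenuation α β s u ≤ 1 := by
  have := Real.rpow_nonneg (div_nonneg hs hu) α
  unfold attenuation
  rw [div_le_one (by positivity)]
  nlinarith [mul_nonneg hβ.le this]

theorem attenuation_anti (hα : 0 < α) (hβ : 0 < β) (hs : 0 ≤ s) (hu : 0 < u) {s' : ℝ}
    (hss : s ≤ s') : attenuation α β s' u ≤ attenuation α β s u := by
  have h0 := Real.rpow_nonneg (div_nonneg hs hu.le) α
  have h1 : (s / u) ^ α ≤ (s' / u) ^ α :=
    Real.rpow_le_rpow (div_nonneg hs hu.le) (by gcongr) hα.le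
  unfold attenuation
  gcongr

@[fun_prop]
theorem measurable_attenuation {E : Type*} [MeasurableSpace E] {f g : E → ℝ} (hf : Measurable f)
    (hg : Measurable g) : Measurable fun x => attenuation α β (f x) (g x) := by
  unfold attenuation
  fun_prop

theorem continuousAt_attenuation (hα : 0 < α) (hβ : 0 < β) (hs : 0 ≤ s) (hu : 0 < u) :
    ContinuousAt (attenuation α β s) u := by
  have h0 := Real.rpow_nonneg (div_nonneg hs hu.le) α
  unfold attenuation
  refine ContinuousAt.div continuousAt_const (continuousAt_const.add (continuousAt_const.mul ?_))
    (by positivity)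
  exact (continuousAt_const.div continuousAt_id hu.ne').rpow_const (Or.inr hα.le)

/-- The left side is the integrand in the exponent of the Poisson Laplace functional in polar
coordinates; this identifies it with the stated kernel. -/
theorem one_sub_attenuation_mul (hβ : 0 < β) (hs : 0 < s) (hu : 0 < u) :
    (1 - attenuation α β s u) * u = kernelFn α β s u := by
  unfold attenuation kernelFn
  have h1 : (u / s) ^ α = ((s / u) ^ α)⁻¹ := by
    rw [← Real.inv_rpow (by positivity), inv_div]
  have h2 : 0 < (s / u) ^ α := Real.rpow_pos_of_pos (by positivity) α
  rw [h1]
  field_simp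
  ring

theorem kernelFn_nonneg (hβ : 0 < β) (hs : 0 ≤ s) (hu : 0 ≤ u) : 0 ≤ kernelFn α β s u := by
  have := Real.rpow_nonneg (div_nonneg hu hs) α
  unfold kernelFn
  positivity

@[fun_prop]
theorem measurable_kernelFn {E : Type*} [MeasurableSpace E] {f g : E → ℝ} (hf : Measurable f)
    (hg : Measurable g) : Measurable fun x => kernelFn α β (f x) (g x) := by
  unfold kernelFn
  fun_prop

/-- Dropping the 1 in the denominator bounds the kernel by `β a ^ α u ^ (1 - α)`, which is
integrable at infinity exactly because `α > 2`. -/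
theorem integrableOn_kernelFn (hα : 2 < α) (hβ : 0 < β) {a b : ℝ} (ha : 0 < a) (hb : 0 < b) :
    IntegrableOn (kernelFn α β a) (Set.Ioi b) := by
  have hint : IntegrableOn (fun u : ℝ => β * a ^ α * u ^ (1 - α)) (Set.Ioi b) :=
    (integrableOn_Ioi_rpow_of_lt (by linarith) hb).const_mul _
  refine Integrable.mono' hint
    (measurable_kernelFn measurable_const measurable_id).aestronglyMeasurable ?_
  filter_upwards [self_mem_ae_restrict measurableSet_Ioi] with u hu
  have hu0 : 0 < u := hb.trans hu
  rw [Real.norm_of_nonneg (kernelFn_nonneg hβ ha.le hu0.le), kernelFn, Real.rpow_sub hu0,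
    Real.rpow_one, Real.div_rpow hu0.le ha.le]
  have h1 : 0 < u ^ α := Real.rpow_pos_of_pos hu0 α
  have h2 : 0 < a ^ α := Real.rpow_pos_of_pos ha α
  calc 1 / (1 + β⁻¹ * (u ^ α / a ^ α)) * u ≤ 1 / (β⁻¹ * (u ^ α / a ^ α)) * u := by
        gcongr
        linarith
    _ = β * a ^ α * (u / u ^ α) := by field_simp

end Attenuation

/-! ### Integrating out the point counts in successive rings. -/

section Grid

variable {Ω : Type*} {mΩ : MeasurableSpace Ω} {Pr : Measure Ω} {φ : Ω → Set Plane} {lam : ℝ}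

/-- Since `Y` and `z` are known from `m` and the count is independent of `m`, the Poisson generating
function `exp (-mean * (1 - z))` may be applied with `z` frozen. -/
theorem lintegral_mul_pow_ring {m mΩ : MeasurableSpace Ω} {Pr : Measure Ω} [IsProbabilityMeasure Pr]
    (h : IsPoissonPointProcess Pr φ lam) (hm : m ≤ mΩ) (hlam : 0 < lam)
    {a b : ℝ} (ha : 0 ≤ a) (hab : a ≤ b)
    (hind : Indep m (MeasurableSpace.comap (pointCount φ (ring a b)) ⊤) Pr)
    {Y : Ω → ENNReal} (hY : Measurable[m] Y) {z : Ω → ℝ} (hz : Measurable[m] z)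
    (hz0 : ∀ ω, 0 ≤ z ω) :
    ∫⁻ ω, Y ω * ENNReal.ofReal (z ω) ^ (pointCount φ (ring a b) ω).toNat ∂Pr =
      ∫⁻ ω, Y ω * ENNReal.ofReal
        (Real.exp (-(lam * (Real.pi * (b ^ 2 - a ^ 2)) * (1 - z ω)))) ∂Pr := by
  have hcount : Measurable (pointCount φ (ring a b)) := h.measurable_count _ (measurableSet_ring a b)
  have hN : Measurable fun ω => (pointCount φ (ring a b) ω).toNat :=
    (Measurable.of_discrete (f := ENat.toNat)).comp hcount
  have hind' : Indep m (MeasurableSpace.comap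
      (fun ω => (pointCount φ (ring a b) ω).toNat) inferInstance) Pr := by
    refine indep_of_indep_of_le_right hind ?_
    rintro _ ⟨s, -, rfl⟩
    exact ⟨ENat.toNat ⁻¹' s, trivial, rfl⟩
  rw [lintegral_indep_eq_lintegral_lintegral (a := fun ω => (Y ω, z ω)) hm hN hind' (hY.prodMk hz)
    (f := fun y n => y.1 * ENNReal.ofReal y.2 ^ n) (by
      refine measurable_from_prod_countable_left fun n => ?_
      show Measurable fun y : ENNReal × ℝ => y.1 * ENNReal.ofReal y.2 ^ n
      fun_prop)]
  refine lintegral_congr fun ω => ?_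
  rw [h.law_toNat (measurableSet_ring a b) (volume_ring_ne_top a b),
    lintegral_const_mul _ Measurable.of_discrete, lintegral_pow_poissonMeasure _ (hz0 ω),
    volume_real_ring ha hab, Real.coe_toNNReal]
  have : a ^ 2 ≤ b ^ 2 := by gcongr
  have := sub_nonneg.2 this
  positivity

/-- What is known, up to null sets, from the points within distance `t` and from the further
source `𝓡`. -/
@[reducible] noncomputable def insideSigma {Ω : Type*} {mΩ : MeasurableSpace Ω} (Pr : Measure Ω)
    (φ : Ω → Set Plane) (𝓡 : MeasurableSpace Ω) (t : ℝ) : MeasurableSpace Ω :=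
  nullExtension Pr (restrictSigma φ (Metric.closedBall 0 t) ⊔ 𝓡)

theorem insideSigma_mono (𝓡 : MeasurableSpace Ω) {mΩ : MeasurableSpace Ω} {Pr : Measure Ω} :
    Monotone (insideSigma Pr φ 𝓡) := fun _ _ hab =>
  nullExtension_mono (sup_le_sup_right
    (restrictSigma_mono φ (Metric.closedBall_subset_closedBall hab)) 𝓡)

theorem insideSigma_le (𝓡 : MeasurableSpace Ω) {mΩ : MeasurableSpace Ω} {Pr : Measure Ω} (t : ℝ) :
    insideSigma Pr φ 𝓡 t ≤ mΩ := inf_le_right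

theorem le_insideSigma {𝓡 mΩ : MeasurableSpace Ω} {Pr : Measure Ω}
    (h : IsPoissonPointProcess Pr φ lam) (hR : 𝓡 ≤ mΩ) (t : ℝ) :
    restrictSigma φ (Metric.closedBall 0 t) ⊔ 𝓡 ≤ insideSigma Pr φ 𝓡 t :=
  le_nullExtension (sup_le ((restrictSigma_le_pointSigma φ _).trans (pointSigma_le h)) hR)

theorem indep_insideSigma {𝓡 mΩ : MeasurableSpace Ω} {Pr : Measure Ω} [IsProbabilityMeasure Pr]
    (h : IsPoissonPointProcess Pr φ lam) (hR : 𝓡 ≤ mΩ) (hind : Indep (pointSigma φ) 𝓡 Pr)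
    (a b : ℝ) :
    Indep (insideSigma Pr φ 𝓡 a) (MeasurableSpace.comap (pointCount φ (ring a b)) ⊤) Pr := by
  have hc : MeasurableSpace.comap (pointCount φ (ring a b)) ⊤ ≤ pointSigma φ :=
    le_iSup₂_of_le (ring a b) (measurableSet_ring a b) le_rfl
  refine indep_nullExtension (indep_sup_of_indep
    ((restrictSigma_le_pointSigma φ _).trans (pointSigma_le h)) (hc.trans (pointSigma_le h)) hR
    (indep_restrictSigma_pointCount h measurableSet_closedBall (measurableSet_ring a b)
      Set.disjoint_sdiff_right) ?_)
  exact indep_of_indep_of_le_left hind (sup_le (restrictSigma_le_pointSigma φ _) hc)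

/-- Rings are removed from the outermost inwards: the factors of the inner rings are known within
radius `J * δ` and so are independent of the count in ring `J`. -/
theorem lintegral_mul_prod_ring {𝓡 mΩ : MeasurableSpace Ω} {Pr : Measure Ω}
    [IsProbabilityMeasure Pr]
    (h : IsPoissonPointProcess Pr φ lam) (hlam : 0 < lam) (hR : 𝓡 ≤ mΩ)
    (hind : Indep (pointSigma φ) 𝓡 Pr) {δ : ℝ} (hδ : 0 < δ) {k J : ℕ} (hkJ : k ≤ J)
    {z : ℕ → Ω → ℝ} (hz : ∀ j, Measurable[insideSigma Pr φ 𝓡 (k * δ)] (z j))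
    (hz0 : ∀ j ω, 0 ≤ z j ω)
    {Y : Ω → ENNReal} (hY : Measurable[insideSigma Pr φ 𝓡 (k * δ)] Y) :
    ∫⁻ ω, Y ω * ∏ j ∈ Finset.Ico k J, ENNReal.ofReal (z j ω) ^
        (pointCount φ (ring (j * δ) ((j + 1 : ℕ) * δ)) ω).toNat ∂Pr =
      ∫⁻ ω, Y ω * ∏ j ∈ Finset.Ico k J, ENNReal.ofReal (Real.exp
        (-(lam * (Real.pi * (((j + 1 : ℕ) * δ) ^ 2 - (j * δ) ^ 2)) * (1 - z j ω)))) ∂Pr := by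
  -- `Y` must vary: the factor left by ring `J` depends only on `z J`, known already at radius `k *
  -- δ`, and is absorbed into `Y` before the induction hypothesis is applied.
  induction J, hkJ using Nat.le_induction generalizing Y with
  | base => simp
  | succ J hkJ ih =>
    have hmono : ∀ {i j : ℕ}, i ≤ j → insideSigma Pr φ 𝓡 (i * δ) ≤ insideSigma Pr φ 𝓡 (j * δ) :=
      fun {i j} hij => insideSigma_mono 𝓡 (by gcongr)
    have hmeas : Measurable[insideSigma Pr φ 𝓡 (J * δ)] fun ω =>
        Y ω * ∏ j ∈ Finset.Ico k J, ENNReal.ofReal (z j ω) ^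
          (pointCount φ (ring (j * δ) ((j + 1 : ℕ) * δ)) ω).toNat := by
      refine (hY.mono (hmono hkJ) le_rfl).mul (Finset.measurable_fun_prod _ fun j hj => ?_)
      have hc : Measurable[insideSigma Pr φ 𝓡 (J * δ)]
          (pointCount φ (ring (j * δ) ((j + 1 : ℕ) * δ))) := by
        refine (measurable_pointCount_restrictSigma φ (measurableSet_ring _ _) ?_).mono
          (le_sup_left.trans (le_insideSigma h hR _)) le_rfl
        refine Set.sdiff_subset.trans (Metric.closedBall_subset_closedBall ?_)
        have : j + 1 ≤ J := (Finset.mem_Ico.1 hj).2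
        gcongr
      exact ((hz j).mono (hmono hkJ) le_rfl).ennreal_ofReal.pow
        ((Measurable.of_discrete (f := ENat.toNat)).comp hc)
    have hw : Measurable[insideSigma Pr φ 𝓡 (k * δ)] fun ω => ENNReal.ofReal (Real.exp
        (-(lam * (Real.pi * (((J + 1 : ℕ) * δ) ^ 2 - (J * δ) ^ 2)) * (1 - z J ω)))) :=
      Measurable.ennreal_ofReal (Real.measurable_exp.comp
        ((measurable_const.mul (measurable_const.sub (hz J))).neg))
    have hstep := lintegral_mul_pow_ring h (insideSigma_le 𝓡 _) hlam
      (a := J * δ) (b := (J + 1 : ℕ) * δ) (by positivity)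
      (by gcongr; omega) (indep_insideSigma h hR hind _ _) hmeas
      ((hz J).mono (hmono hkJ) le_rfl) (hz0 J)
    have hih := ih (hY.mul hw)
    simp only [Finset.prod_Ico_succ_top hkJ]
    simp only [Pi.mul_apply] at hih
    refine Eq.trans ?_ (hstep.trans (Eq.trans ?_ (hih.trans ?_)))
    · exact lintegral_congr fun ω => (mul_assoc _ _ _).symm
    · exact lintegral_congr fun ω => mul_right_comm _ _ _
    · exact lintegral_congr fun ω => by rw [mul_assoc, mul_comm (ENNReal.ofReal _)]

end Grid

/-- The σ-algebra of sets whose trace on `E` is `m`-measurable. -/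
@[reducible] def traceSigma {Ω : Type*} (m : MeasurableSpace Ω) (E : Set Ω)
    (hE : MeasurableSet[m] E) : MeasurableSpace Ω where
  MeasurableSet' A := MeasurableSet[m] (A ∩ E)
  measurableSet_empty := by simp
  measurableSet_compl A hA := by
    have : Aᶜ ∩ E = E \ (A ∩ E) := by ext; simp; tauto
    rw [this]
    exact hE.diff hA
  measurableSet_iUnion f hf := by
    rw [Set.iUnion_inter]
    exact MeasurableSet.iUnion hf

/-- The information given by the distances to the `l + 1` nearest points and by `𝓡`. -/
@[reducible] noncomputable def knownSigma {Ω : Type*} (φ : Ω → Set Plane) (𝓡 : MeasurableSpace Ω)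
    (l : ℕ) : MeasurableSpace Ω :=
  (⨆ k : Fin (l + 1), MeasurableSpace.comap (fun ω => nthDist (φ ω) k) inferInstance) ⊔ 𝓡

/-! ### The information up to the point of rank `l`, stopped at the grid. -/

section StoppedInformation

variable {Ω : Type*} {𝓡 mΩ : MeasurableSpace Ω} {Pr : Measure Ω} {φ : Ω → Set Plane} {lam : ℝ}

theorem measurable_nthDist' (h : IsPoissonPointProcess Pr φ lam) (k : ℕ) :
    Measurable fun ω => nthDist (φ ω) k :=
  (measurable_nthDist φ k).mono (pointSigma_le h) le_rfl

theorem knownSigma_le (h : IsPoissonPointProcess Pr φ lam) (hR : 𝓡 ≤ mΩ) (l : ℕ) :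
    knownSigma φ 𝓡 l ≤ mΩ :=
  sup_le (iSup_le fun k => (measurable_nthDist' h k).comap_le) hR

theorem measurable_nthDist_knownSigma (φ : Ω → Set Plane) (𝓡 : MeasurableSpace Ω) {k l : ℕ}
    (hk : k ≤ l) : Measurable[knownSigma φ 𝓡 l] fun ω => nthDist (φ ω) k :=
  measurable_iff_comap_le.2 ((le_iSup (fun k : Fin (l + 1) =>
    MeasurableSpace.comap (fun ω => nthDist (φ ω) k) inferInstance)
      ⟨k, Nat.lt_succ_of_le hk⟩).trans le_sup_left)

theorem measurableSet_nullExtension_congr {m mΩ : MeasurableSpace Ω} {Pr : Measure Ω} {s t : Set Ω}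
    (hs : MeasurableSet s) (ht : MeasurableSet[nullExtension Pr m] t) (h : s =ᵐ[Pr] t) :
    MeasurableSet[nullExtension Pr m] s := by
  obtain ⟨⟨t', ht', htt⟩, -⟩ := MeasurableSpace.measurableSet_inf.1 ht
  exact measurableSet_nullExtension hs ht' (h.trans htt)

/-- Distances below `t` are determined by counts in balls of radius below `t`, but only for locally
finite infinite samples. This exceptional null set is why `insideSigma` is a null extension. -/
theorem measurable_min_nthDist (h : IsPoissonPointProcess Pr φ lam) (hlam : 0 < lam)
    (k : ℕ) (t : ℝ) :
    Measurable[insideSigma Pr φ 𝓡 t] fun ω => min (nthDist (φ ω) k) t := by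
  have hmΩ : Measurable fun ω => min (nthDist (φ ω) k) t :=
    (measurable_nthDist' h k).min measurable_const
  refine measurable_of_Iic (mδ := insideSigma Pr φ 𝓡 t) fun u => ?_
  rcases le_or_gt t u with htu | htu
  · have : (fun ω => min (nthDist (φ ω) k) t) ⁻¹' Set.Iic u = Set.univ := by
      ext ω; simp [htu]
    rw [this]
    exact MeasurableSet.univ
  rcases lt_or_ge u 0 with hu | hu
  · have : (fun ω => min (nthDist (φ ω) k) t) ⁻¹' Set.Iic u = ∅ := by
      ext ω
      simp [htu, hu.trans_le (nthDist_nonneg (φ ω) k)]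
    rw [this]
    exact @MeasurableSet.empty _ (insideSigma Pr φ 𝓡 t)
  · have hset : MeasurableSet[restrictSigma φ (Metric.closedBall 0 t) ⊔ 𝓡]
        {ω | (k : ℕ∞) < pointCount φ (Metric.closedBall 0 u) ω} := by
      refine (le_sup_left : _ ≤ restrictSigma φ (Metric.closedBall 0 t) ⊔ 𝓡) _ ?_
      exact measurable_pointCount_restrictSigma φ measurableSet_closedBall
        (Metric.closedBall_subset_closedBall htu.le)
        (MeasurableSet.of_discrete (s := Set.Ioi (k : ℕ∞)))
    refine measurableSet_nullExtension (hmΩ measurableSet_Iic) hset ?_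
    filter_upwards [ae_isLocallyFiniteInfinite h hlam] with ω hω
    refine propext ?_
    show min (nthDist (φ ω) k) t ≤ u ↔ (k : ℕ∞) < (φ ω ∩ Metric.closedBall 0 u).encard
    rw [hω.lt_encard_iff hu, min_le_iff, or_iff_left (not_le.2 htu)]

theorem measurableSet_nthDist_le (h : IsPoissonPointProcess Pr φ lam) (hlam : 0 < lam)
    (k : ℕ) (t : ℝ) :
    MeasurableSet[insideSigma Pr φ 𝓡 t] {ω | nthDist (φ ω) k ≤ t} := by
  have hset : MeasurableSet[restrictSigma φ (Metric.closedBall 0 t) ⊔ 𝓡]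
      {ω | 0 ≤ t ∧ (k : ℕ∞) < pointCount φ (Metric.closedBall 0 t) ω} := by
    refine MeasurableSet.inter (MeasurableSet.const _)
      ((le_sup_left : _ ≤ restrictSigma φ (Metric.closedBall 0 t) ⊔ 𝓡) _ ?_)
    exact measurable_pointCount_restrictSigma φ measurableSet_closedBall subset_rfl
      (MeasurableSet.of_discrete (s := Set.Ioi (k : ℕ∞)))
  refine measurableSet_nullExtension (measurable_nthDist' h k measurableSet_Iic) hset ?_
  filter_upwards [ae_isLocallyFiniteInfinite h hlam] with ω hω
  refine propext ?_
  show nthDist (φ ω) k ≤ t ↔ 0 ≤ t ∧ (k : ℕ∞) < (φ ω ∩ Metric.closedBall 0 t).encard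
  constructor
  · intro hk
    have ht := (nthDist_nonneg (φ ω) k).trans hk
    exact ⟨ht, (hω.lt_encard_iff ht k).2 hk⟩
  · rintro ⟨ht, hk⟩
    exact (hω.lt_encard_iff ht k).1 hk

/-- The events whose trace on `nthDist (φ ω) l ≤ t` is known within radius `t` form a σ-algebra, so
generators suffice. On that trace every distance of rank at most `l` equals its minimum with `t`. -/
theorem measurableSet_inter_nthDist_le (h : IsPoissonPointProcess Pr φ lam) (hlam : 0 < lam)
    (hR : 𝓡 ≤ mΩ) {l : ℕ} (t : ℝ) {A : Set Ω} (hA : MeasurableSet[knownSigma φ 𝓡 l] A) :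
    MeasurableSet[insideSigma Pr φ 𝓡 t] (A ∩ {ω | nthDist (φ ω) l ≤ t}) := by
  have hE := measurableSet_nthDist_le (𝓡 := 𝓡) h hlam l t
  suffices hle : knownSigma φ 𝓡 l ≤ traceSigma (insideSigma Pr φ 𝓡 t) _ hE from hle A hA
  refine sup_le (iSup_le fun k => ?_) ?_
  · rintro _ ⟨B, hB, rfl⟩
    refine measurableSet_nullExtension_congr
      (((measurable_nthDist' h k) hB).inter (insideSigma_le 𝓡 t _ hE))
      (MeasurableSet.inter (measurable_min_nthDist (𝓡 := 𝓡) h hlam k t hB) hE) ?_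
    filter_upwards [ae_isLocallyFiniteInfinite h hlam] with ω hω
    refine propext ?_
    show nthDist (φ ω) k ∈ B ∧ nthDist (φ ω) l ≤ t ↔
      min (nthDist (φ ω) k) t ∈ B ∧ nthDist (φ ω) l ≤ t
    refine and_congr_left fun hl => ?_
    rw [min_eq_left ((hω.monotone_nthDist (Nat.lt_succ_iff.1 k.2)).trans hl)]
  · intro A hA
    exact MeasurableSet.inter ((le_sup_right.trans (le_insideSigma h hR t)) A hA) hE

/-- The index of the grid cell `((k - 1) δ, k δ]` that contains the point of rank `l`. -/
noncomputable def gridIndex (φ : Ω → Set Plane) (l : ℕ) (δ : ℝ) (ω : Ω) : ℕ :=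
  ⌈nthDist (φ ω) l / δ⌉₊

theorem gridIndex_le_iff {δ : ℝ} (hδ : 0 < δ) (l k : ℕ) (ω : Ω) :
    gridIndex φ l δ ω ≤ k ↔ nthDist (φ ω) l ≤ k * δ := by
  rw [gridIndex, Nat.ceil_le, div_le_iff₀ hδ]

theorem measurableSet_gridIndex_eq (h : IsPoissonPointProcess Pr φ lam) (hlam : 0 < lam)
    {δ : ℝ} (hδ : 0 < δ) (l k : ℕ) :
    MeasurableSet[insideSigma Pr φ 𝓡 (k * δ)] {ω | gridIndex φ l δ ω = k} := by
  have hset : {ω | gridIndex φ l δ ω = k} = {ω | nthDist (φ ω) l ≤ k * δ} ∩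
      ⋂ j : {j : ℕ // j < k}, {ω | nthDist (φ ω) l ≤ j * δ}ᶜ := by
    ext ω
    simp only [Set.mem_ofPred_eq, Set.mem_inter_iff, Set.mem_iInter, Set.mem_compl_iff,
      ← gridIndex_le_iff hδ, Subtype.forall]
    constructor
    · rintro rfl
      exact ⟨le_rfl, fun j hj => not_le.2 hj⟩
    · rintro ⟨h1, h2⟩
      exact h1.antisymm (not_lt.1 fun hlt => h2 _ hlt le_rfl)
  rw [hset]
  refine MeasurableSet.inter (measurableSet_nthDist_le h hlam l _)
    (MeasurableSet.iInter fun j => MeasurableSet.compl ?_)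
  refine insideSigma_mono 𝓡 ?_ _ (measurableSet_nthDist_le h hlam l (j * δ))
  have := j.2.le
  gcongr

/-- The grid index is a stopping time for the σ-algebras `insideSigma` at radii `k * δ`. Restricted
to the event that it equals `k`, the information on the first `l + 1` distances is known within
radius `k * δ`. -/
theorem measurable_indicator_gridIndex_eq {F : Type*} [MeasurableSpace F] [Zero F]
    (h : IsPoissonPointProcess Pr φ lam) (hlam : 0 < lam)
    (hR : 𝓡 ≤ mΩ) {δ : ℝ} (hδ : 0 < δ) {l : ℕ} (k : ℕ) {Y : Ω → F}
    (hY : Measurable[knownSigma φ 𝓡 l] Y) :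
    Measurable[insideSigma Pr φ 𝓡 (k * δ)] ({ω | gridIndex φ l δ ω = k}.indicator Y) := by
  intro B hB
  have hE := measurableSet_gridIndex_eq (𝓡 := 𝓡) h hlam hδ l k
  rw [Set.indicator_preimage, Set.ite]
  refine MeasurableSet.union ?_ (MeasurableSet.diff ?_ hE)
  · have : Y ⁻¹' B ∩ {ω | gridIndex φ l δ ω = k} =
        Y ⁻¹' B ∩ {ω | nthDist (φ ω) l ≤ k * δ} ∩ {ω | gridIndex φ l δ ω = k} := by
      ext ω
      simp only [Set.mem_inter_iff, Set.mem_ofPred_eq, and_assoc]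
      refine and_congr_right fun _ => (and_iff_right_of_imp fun hk => ?_).symm
      exact (gridIndex_le_iff hδ l k ω).1 hk.le
    rw [this]
    exact MeasurableSet.inter (measurableSet_inter_nthDist_le h hlam hR _ (hY hB)) hE
  · exact measurable_const hB

/-- Integrating out the counts in the rings outside the grid cell of the point of rank `l`. -/
theorem lintegral_sum_gridIndex (h : IsPoissonPointProcess Pr φ lam) [IsProbabilityMeasure Pr]
    (hlam : 0 < lam) (hR : 𝓡 ≤ mΩ) (hind : Indep (pointSigma φ) 𝓡 Pr) {δ : ℝ} (hδ : 0 < δ)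
    {α β : ℝ} (hβ : 0 < β) {l : ℕ} (J : ℕ)
    {Y : Ω → ENNReal} (hY : Measurable[knownSigma φ 𝓡 l] Y) :
    ∫⁻ ω, ∑ k ∈ Finset.range (J + 1), {ω | gridIndex φ l δ ω = k}.indicator (fun ω =>
      Y ω * ∏ j ∈ Finset.Ico k J,
        ENNReal.ofReal (attenuation α β (nthDist (φ ω) 0) ((j + 1 : ℕ) * δ)) ^
          (pointCount φ (ring (j * δ) ((j + 1 : ℕ) * δ)) ω).toNat) ω ∂Pr =
    ∫⁻ ω, ∑ k ∈ Finset.range (J + 1), {ω | gridIndex φ l δ ω = k}.indicator (fun ω =>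
      Y ω * ∏ j ∈ Finset.Ico k J, ENNReal.ofReal (Real.exp
        (-(lam * (Real.pi * (((j + 1 : ℕ) * δ) ^ 2 - (j * δ) ^ 2)) *
          (1 - attenuation α β (nthDist (φ ω) 0) ((j + 1 : ℕ) * δ)))))) ω ∂Pr := by
  have hdist := measurable_nthDist' h 0
  have hYm : Measurable Y := hY.mono (knownSigma_le h hR l) le_rfl
  have hE : ∀ k, MeasurableSet {ω | gridIndex φ l δ ω = k} := fun k =>
    insideSigma_le 𝓡 _ _ (measurableSet_gridIndex_eq (𝓡 := 𝓡) h hlam hδ l k)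
  rw [lintegral_finsetSum, lintegral_finsetSum]
  · refine Finset.sum_congr rfl fun k hk => ?_
    have hkJ : k ≤ J := Nat.lt_succ_iff.1 (Finset.mem_range.1 hk)
    have hs := measurable_indicator_gridIndex_eq h hlam hR hδ k
      (measurable_nthDist_knownSigma φ 𝓡 (Nat.zero_le l))
    -- The nearest distance is known within radius `k * δ` only on the event of the cell, so its
    -- indicator version enters `z`. Off the event the factor `Y` vanishes and the value of `z` is
    -- irrelevant.
    have hkey := lintegral_mul_prod_ring h hlam hR hind hδ hkJ
      (z := fun j ω => attenuation α β ({ω | gridIndex φ l δ ω = k}.indicator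
        (fun ω => nthDist (φ ω) 0) ω) ((j + 1 : ℕ) * δ))
      (fun j => (measurable_attenuation measurable_id measurable_const).comp hs)
      (fun j ω => attenuation_nonneg hβ
        (Set.indicator_nonneg (fun ω _ => nthDist_nonneg (φ ω) 0) ω) (by positivity))
      (measurable_indicator_gridIndex_eq h hlam hR hδ k hY)
    refine Eq.trans (lintegral_congr fun ω => ?_) (hkey.trans (lintegral_congr fun ω => ?_))
    · by_cases hω : ω ∈ {ω | gridIndex φ l δ ω = k}
      · simp only [Set.indicator_of_mem hω]
      · simp only [Set.indicator_of_notMem hω, zero_mul]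
    · by_cases hω : ω ∈ {ω | gridIndex φ l δ ω = k}
      · simp only [Set.indicator_of_mem hω]
      · simp only [Set.indicator_of_notMem hω, zero_mul]
  · intro k hk
    refine Measurable.indicator ?_ (hE k)
    fun_prop
  · intro k hk
    refine Measurable.indicator ?_ (hE k)
    refine hYm.mul (Finset.measurable_fun_prod _ fun j _ => Measurable.pow (by fun_prop) ?_)
    exact (Measurable.of_discrete (f := ENat.toNat)).comp
      (h.measurable_count _ (measurableSet_ring _ _))

end StoppedInformation

/-- The least multiple of `δ` that is at least `u`. -/
noncomputable def gridUp (δ u : ℝ) : ℝ := (⌈u / δ⌉₊ : ℝ) * δ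

/-! ### Rounding radii up to the grid, and limits for vanishing mesh. -/

section GridUp

variable {δ u : ℝ}

theorem le_gridUp (hδ : 0 < δ) : u ≤ gridUp δ u := by
  rw [gridUp, ← div_le_iff₀ hδ]
  exact Nat.le_ceil _

theorem gridUp_nonneg (hδ : 0 < δ) : 0 ≤ gridUp δ u := by
  unfold gridUp
  positivity

theorem gridUp_lt (hδ : 0 < δ) (hu : 0 ≤ u) : gridUp δ u < u + δ := by
  have h := Nat.ceil_lt_add_one (div_nonneg hu hδ.le)
  calc gridUp δ u < (u / δ + 1) * δ := mul_lt_mul_of_pos_right h hδ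
    _ = u + δ := by field_simp

@[fun_prop]
theorem measurable_gridUp (δ : ℝ) : Measurable (gridUp δ) := by
  unfold gridUp
  have : Measurable fun u : ℝ => ⌈u / δ⌉₊ := Nat.measurable_ceil.comp (by fun_prop)
  have h2 : Measurable fun u : ℝ => ((⌈u / δ⌉₊ : ℕ) : ℝ) := measurable_from_nat.comp this
  exact h2.mul_const δ

theorem tendsto_gridUp (hu : 0 ≤ u) :
    Tendsto (fun n : ℕ => gridUp (1 / ((n : ℝ) + 1)) u) atTop (𝓝 u) := by
  have hup : Tendsto (fun n : ℕ => u + 1 / ((n : ℝ) + 1)) atTop (𝓝 u) := by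
    simpa using (tendsto_one_div_add_atTop_nhds_zero_nat (𝕜 := ℝ)).const_add u
  exact tendsto_of_tendsto_of_tendsto_of_le_of_le tendsto_const_nhds hup
    (fun n => le_gridUp (by positivity)) (fun n => (gridUp_lt (by positivity) hu).le)

end GridUp

section Deterministic

variable {S : Set Plane} {δ : ℝ}

/-- All points in the ring of index `j` round up to `(j + 1) * δ`, and their ranks fill the interval
between the counts at its two radii; this regroups the product by rank. -/
theorem prod_ring_eq_prod_rank (hS : IsLocallyFiniteInfinite S) (hδ : 0 < δ) (f : ℕ → ENNReal)
    {k J : ℕ} (hkJ : k ≤ J) :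
    ∏ j ∈ Finset.Ico k J, f (j + 1) ^ (S ∩ ring (j * δ) ((j + 1 : ℕ) * δ)).encard.toNat =
      ∏ p ∈ Finset.Ico (ballCount S (k * δ)) (ballCount S (J * δ)), f ⌈nthDist S p / δ⌉₊ := by
  induction J, hkJ using Nat.le_induction with
  | base => simp
  | succ J hkJ ih =>
    have h1 : ballCount S (k * δ) ≤ ballCount S (J * δ) := ballCount_mono hS (by gcongr)
    have h2 : ballCount S (J * δ) ≤ ballCount S ((J + 1 : ℕ) * δ) :=
      ballCount_mono hS (by gcongr; omega)
    rw [Finset.prod_Ico_succ_top hkJ, ih, ← Finset.prod_Ico_consecutive _ h1 h2,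
      hS.ring_count (by gcongr; omega)]
    congr 1
    rw [Finset.prod_congr rfl (g := fun _ => f (J + 1)), Finset.prod_const, Nat.card_Ico]
    intro p hp
    rw [Finset.mem_Ico, hS.lt_ballCount_iff (by positivity), ← not_lt,
      hS.lt_ballCount_iff (by positivity)] at hp
    congr 1
    rw [Nat.ceil_eq_iff (by omega), div_le_iff₀ hδ]
    refine ⟨?_, hp.2⟩
    rw [Nat.add_sub_cancel, lt_div_iff₀ hδ]
    exact not_le.1 hp.1

/-- On each cell the rounded factor is constant, and `π (b ^ 2 - a ^ 2)` is `2π` times the integral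
of `u` over the cell. -/
theorem sum_ring_eq_integral (hδ : 0 < δ) (f : ℕ → ℝ) {k J : ℕ} (hkJ : k ≤ J) :
    ∑ j ∈ Finset.Ico k J, Real.pi * (((j + 1 : ℕ) * δ) ^ 2 - (j * δ) ^ 2) * f (j + 1) =
      2 * Real.pi * ∫ u in (k * δ : ℝ)..(J * δ), f ⌈u / δ⌉₊ * u := by
  have hcell : ∀ j : ℕ, Set.EqOn (fun u : ℝ => f (j + 1) * u) (fun u : ℝ => f ⌈u / δ⌉₊ * u)
      (Set.uIoc (j * δ) ((j + 1 : ℕ) * δ)) := by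
    intro j u hu
    rw [Set.uIoc_of_le (by gcongr; omega)] at hu
    have : ⌈u / δ⌉₊ = j + 1 := by
      rw [Nat.ceil_eq_iff (by omega), div_le_iff₀ hδ, Nat.add_sub_cancel, lt_div_iff₀ hδ]
      exact hu
    simp only [this]
  rw [← intervalIntegral.sum_integral_adjacent_intervals_Ico (a := fun j : ℕ => (j * δ : ℝ)) hkJ,
    Finset.mul_sum]
  · refine Finset.sum_congr rfl fun j _ => ?_
    rw [← intervalIntegral.integral_congr_ae (Eventually.of_forall (hcell j)), intervalIntegral.integral_const_mul,
      integral_id]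
    ring
  · intro j _
    exact (Continuous.intervalIntegrable (by fun_prop) _ _).congr (hcell j)

/-- Once rounding moves `nthDist S l` by less than the gap to the next distance, the rounded ball
holds exactly `l + 1` points, so the product starts at rank `l + 1`. Without strict monotonicity a
point sharing the radius of rank `l` would be lost. -/
theorem tendsto_prod_gridUp (hS : IsLocallyFiniteInfinite S)
    (h0 : (S ∩ Metric.closedBall 0 0).encard = 0) (hs : StrictMono (nthDist S)) {α β s : ℝ}
    (hα : 0 < α) (hβ : 0 < β) (hs0 : 0 ≤ s) (l m : ℕ) :
    Tendsto (fun n : ℕ => ∏ p ∈ Finset.Ico (ballCount S (gridUp (1 / ((n : ℝ) + 1)) (nthDist S l))) m,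
      ENNReal.ofReal (attenuation α β s (gridUp (1 / ((n : ℝ) + 1)) (nthDist S p)))) atTop
      (𝓝 (∏ p ∈ Finset.Ico (l + 1) m, ENNReal.ofReal (attenuation α β s (nthDist S p)))) := by
  have hcount : ∀ᶠ n : ℕ in atTop,
      ballCount S (gridUp (1 / ((n : ℝ) + 1)) (nthDist S l)) = l + 1 := by
    filter_upwards [(tendsto_gridUp (nthDist_nonneg S l)).eventually_lt_const
      (hs (Nat.lt_succ_self l))] with n hn
    have hδ : (0 : ℝ) < 1 / ((n : ℝ) + 1) := by positivity
    have h1 : l < ballCount S (gridUp (1 / ((n : ℝ) + 1)) (nthDist S l)) :=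
      (hS.lt_ballCount_iff (gridUp_nonneg hδ)).2 (le_gridUp hδ)
    have h2 : ¬ l + 1 < ballCount S (gridUp (1 / ((n : ℝ) + 1)) (nthDist S l)) := by
      rw [hS.lt_ballCount_iff (gridUp_nonneg hδ)]
      exact not_le.2 hn
    omega
  have hlim : Tendsto (fun n : ℕ => ∏ p ∈ Finset.Ico (l + 1) m,
      ENNReal.ofReal (attenuation α β s (gridUp (1 / ((n : ℝ) + 1)) (nthDist S p)))) atTop
      (𝓝 (∏ p ∈ Finset.Ico (l + 1) m, ENNReal.ofReal (attenuation α β s (nthDist S p)))) := by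
    have hnn : ∀ (n : ℕ) (p : ℕ),
        0 ≤ attenuation α β s (gridUp (1 / ((n : ℝ) + 1)) (nthDist S p)) := fun n p =>
      attenuation_nonneg hβ hs0 (gridUp_nonneg (by positivity))
    simp_rw [← ENNReal.ofReal_prod_of_nonneg fun p _ => hnn _ p]
    rw [← ENNReal.ofReal_prod_of_nonneg fun p _ =>
      attenuation_nonneg hβ hs0 (nthDist_nonneg S p)]
    refine ENNReal.tendsto_ofReal (tendsto_finsetProd _ fun p _ => ?_)
    exact (continuousAt_attenuation hα hβ hs0 (hS.nthDist_pos h0 p)).tendsto.comp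
      (tendsto_gridUp (nthDist_nonneg S p))
  refine hlim.congr' ?_
  filter_upwards [hcount] with n hn
  rw [hn]

theorem tendsto_integral_gridUp {α β s ρ : ℝ} (hα : 0 < α) (hβ : 0 < β) (hs0 : 0 ≤ s)
    (hρ : 0 < ρ) {R : ℝ} (hρR : ρ ≤ R)
    (hR : ∀ n : ℕ, gridUp (1 / ((n : ℝ) + 1)) ρ ≤ R) :
    Tendsto (fun n : ℕ => ∫ u in (gridUp (1 / ((n : ℝ) + 1)) ρ)..R,
      (1 - attenuation α β s (gridUp (1 / ((n : ℝ) + 1)) u)) * u) atTop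
      (𝓝 (∫ u in ρ..R, (1 - attenuation α β s u) * u)) := by
  -- The moving lower limit becomes an indicator on the fixed interval `(0, R]`, where the integrand
  -- is bounded by `R`, as `1 - attenuation` lies in `[0, 1]`.
  have hset : ∀ (a : ℝ) (f : ℝ → ℝ), 0 ≤ a → a ≤ R →
      ∫ u in a..R, f u = ∫ u in Set.Ioc 0 R, (Set.Ioi a).indicator f u := by
    intro a f ha haR
    rw [intervalIntegral.integral_of_le haR, setIntegral_indicator measurableSet_Ioi,
      Set.Ioc_inter_Ioi, max_eq_right ha]
  rw [hset ρ _ hρ.le hρR]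
  simp_rw [fun n : ℕ => hset _ (fun u => (1 - attenuation α β s (gridUp (1 / ((n : ℝ) + 1)) u)) * u)
    (gridUp_nonneg (u := ρ) (show (0 : ℝ) < 1 / ((n : ℝ) + 1) by positivity)) (hR n)]
  refine tendsto_integral_of_dominated_convergence (fun _ => R) (fun n => ?_) ?_ (fun n => ?_) ?_
  · exact (Measurable.indicator (by fun_prop) measurableSet_Ioi).aestronglyMeasurable
  · exact integrableOn_const measure_Ioc_lt_top.ne
  · filter_upwards [self_mem_ae_restrict measurableSet_Ioc] with u hu
    have hδ : (0 : ℝ) < 1 / ((n : ℝ) + 1) := by positivity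
    have h1 := attenuation_nonneg (α := α) hβ hs0 (gridUp_nonneg (u := u) hδ)
    have h2 := attenuation_le_one (α := α) hβ hs0 (gridUp_nonneg (u := u) hδ)
    refine (norm_indicator_le_norm_self _ _).trans ?_
    rw [Real.norm_of_nonneg (mul_nonneg (by linarith) hu.1.le)]
    nlinarith [hu.1, hu.2]
  · filter_upwards [self_mem_ae_restrict measurableSet_Ioc] with u hu
    rcases le_or_gt u ρ with huρ | huρ
    · refine tendsto_nhds_of_eventually_eq (Eventually.of_forall fun n => ?_)
      rw [Set.indicator_of_notMem (Set.notMem_Ioi.2 huρ), Set.indicator_of_notMem]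
      exact Set.notMem_Ioi.2 (huρ.trans (le_gridUp (by positivity)))
    · rw [Set.indicator_of_mem (by simpa using huρ)]
      have hlim : Tendsto (fun n : ℕ =>
          (1 - attenuation α β s (gridUp (1 / ((n : ℝ) + 1)) u)) * u) atTop
          (𝓝 ((1 - attenuation α β s u) * u)) :=
        (((continuousAt_attenuation hα hβ hs0 hu.1).tendsto.comp
          (tendsto_gridUp hu.1.le)).const_sub 1).mul_const u
      refine hlim.congr' ?_
      filter_upwards [(tendsto_gridUp hρ.le).eventually_lt_const huρ] with n hn
      rw [Set.indicator_of_mem (by simpa using hn)]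

end Deterministic

/-! ### The Laplace functional of the points beyond rank `l`. -/

section Laplace

variable {Ω : Type*} {𝓡 mΩ : MeasurableSpace Ω} {Pr : Measure Ω} {φ : Ω → Set Plane} {lam : ℝ}

theorem sum_indicator_eq_ite {κ : Ω → ℕ} (J : ℕ) (X : ℕ → Ω → ENNReal) (ω : Ω) :
    ∑ k ∈ Finset.range (J + 1), {ω | κ ω = k}.indicator (X k) ω =
      if κ ω ≤ J then X (κ ω) ω else 0 := by
  have : ∀ k, {ω | κ ω = k}.indicator (X k) ω = if κ ω = k then X k ω else 0 := fun k => by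
    simp [Set.indicator_apply]
  simp_rw [this, Finset.sum_ite_eq, Finset.mem_range, Nat.lt_succ_iff]

/-- The contribution of the interferers within distance `R`. -/
theorem lintegral_mul_prod_attenuation_ball (h : IsPoissonPointProcess Pr φ lam)
    [IsProbabilityMeasure Pr] (hlam : 0 < lam) (hR : 𝓡 ≤ mΩ) (hind : Indep (pointSigma φ) 𝓡 Pr)
    {α β : ℝ} (hα : 0 < α) (hβ : 0 < β) {l : ℕ} (R : ℕ)
    {Y : Ω → ENNReal} (hY : Measurable[knownSigma φ 𝓡 l] Y) (hY1 : ∀ ω, Y ω ≤ 1)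
    {f g : Ω → ENNReal}
    (hf : f = fun ω => if nthDist (φ ω) l ≤ R then Y ω * ∏ p ∈ Finset.Ico (l + 1) (ballCount (φ ω) R),
      ENNReal.ofReal (attenuation α β (nthDist (φ ω) 0) (nthDist (φ ω) p)) else 0)
    (hg : g = fun ω => if nthDist (φ ω) l ≤ R then Y ω * ENNReal.ofReal (Real.exp
      (-(2 * Real.pi * lam * ∫ u in (nthDist (φ ω) l)..R,
        (1 - attenuation α β (nthDist (φ ω) 0) u) * u))) else 0) :
    AEMeasurable f Pr ∧ AEMeasurable g Pr ∧ ∫⁻ ω, f ω ∂Pr = ∫⁻ ω, g ω ∂Pr := by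
  have hdist := measurable_nthDist' h 0
  have hYm : Measurable Y := hY.mono (knownSigma_le h hR l) le_rfl
  have hδ : ∀ n : ℕ, (0 : ℝ) < 1 / ((n : ℝ) + 1) := fun n => by positivity
  have hJ : ∀ n : ℕ, ((R * (n + 1) : ℕ) : ℝ) * (1 / ((n : ℝ) + 1)) = R := fun n => by
    push_cast
    field_simp
  have hE : ∀ n k : ℕ, MeasurableSet {ω | gridIndex φ l (1 / ((n : ℝ) + 1)) ω = k} := fun n k =>
    insideSigma_le 𝓡 _ _ (measurableSet_gridIndex_eq (𝓡 := 𝓡) h hlam (hδ n) l k)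
  let A : ℕ → ℕ → Ω → ENNReal := fun n k ω => Y ω * ∏ j ∈ Finset.Ico k (R * (n + 1)),
    ENNReal.ofReal (attenuation α β (nthDist (φ ω) 0) ((j + 1 : ℕ) * (1 / ((n : ℝ) + 1)))) ^
      (pointCount φ (ring (j * (1 / ((n : ℝ) + 1))) ((j + 1 : ℕ) * (1 / ((n : ℝ) + 1)))) ω).toNat
  let B : ℕ → ℕ → Ω → ENNReal := fun n k ω => Y ω * ∏ j ∈ Finset.Ico k (R * (n + 1)),
    ENNReal.ofReal (Real.exp (-(lam * (Real.pi * (((j + 1 : ℕ) * (1 / ((n : ℝ) + 1))) ^ 2 -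
      (j * (1 / ((n : ℝ) + 1))) ^ 2)) *
        (1 - attenuation α β (nthDist (φ ω) 0) ((j + 1 : ℕ) * (1 / ((n : ℝ) + 1)))))))
  let F : (ℕ → ℕ → Ω → ENNReal) → ℕ → Ω → ENNReal := fun X n ω =>
    ∑ k ∈ Finset.range (R * (n + 1) + 1),
      {ω | gridIndex φ l (1 / ((n : ℝ) + 1)) ω = k}.indicator (X n k) ω
  have hFG : ∀ n, ∫⁻ ω, F A n ω ∂Pr = ∫⁻ ω, F B n ω ∂Pr := fun n =>
    lintegral_sum_gridIndex h hlam hR hind (hδ n) hβ (R * (n + 1)) hY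
  have hFm : ∀ X : ℕ → ℕ → Ω → ENNReal, (∀ n k, Measurable (X n k)) → ∀ n, Measurable (F X n) :=
    fun X hX n => Finset.measurable_fun_sum _ fun k _ => (hX n k).indicator (hE n k)
  have hAm : ∀ n k, Measurable (A n k) := fun n k =>
    hYm.mul (Finset.measurable_fun_prod _ fun j _ => Measurable.pow (by fun_prop)
      ((Measurable.of_discrete (f := ENat.toNat)).comp (h.measurable_count _ (measurableSet_ring _ _))))
  have hBm : ∀ n k, Measurable (B n k) := fun n k => by
    refine hYm.mul (Finset.measurable_fun_prod _ fun j _ => ?_)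
    fun_prop
  have hF1 : ∀ X : ℕ → ℕ → Ω → ENNReal, (∀ n k ω, X n k ω ≤ 1) → ∀ n ω, F X n ω ≤ 1 := by
    intro X hX n ω
    show ∑ k ∈ _, _ ≤ _
    rw [sum_indicator_eq_ite]
    split_ifs
    · exact hX _ _ _
    · exact zero_le
  have hA1 : ∀ n k ω, A n k ω ≤ 1 := fun n k ω => by
    refine mul_le_one' (hY1 ω) (Finset.prod_le_one' fun j _ => pow_le_one' ?_ _)
    rw [ENNReal.ofReal_le_one]
    exact attenuation_le_one hβ (nthDist_nonneg _ _) (by positivity)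
  have hB1 : ∀ n k ω, B n k ω ≤ 1 := fun n k ω => by
    refine mul_le_one' (hY1 ω) (Finset.prod_le_one' fun j _ => ?_)
    rw [ENNReal.ofReal_le_one, Real.exp_le_one_iff, neg_nonpos]
    have h1 : attenuation α β (nthDist (φ ω) 0) ((j + 1 : ℕ) * (1 / ((n : ℝ) + 1))) ≤ 1 :=
      attenuation_le_one hβ (nthDist_nonneg _ _) (by positivity)
    have h2 : ((j : ℝ) * (1 / ((n : ℝ) + 1))) ^ 2 ≤ ((j + 1 : ℕ) * (1 / ((n : ℝ) + 1))) ^ 2 := by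
      gcongr; omega
    have h3 := sub_nonneg.2 h1
    have h4 := sub_nonneg.2 h2
    positivity
  -- With mesh `1 / (n + 1)` the integer `R` is itself a grid radius, so the truncation event is the
  -- same for every mesh.
  have hiff : ∀ (n : ℕ) ω, gridIndex φ l (1 / ((n : ℝ) + 1)) ω ≤ R * (n + 1) ↔ nthDist (φ ω) l ≤ R :=
    fun n ω => by rw [gridIndex_le_iff (hδ n), hJ]
  have hAlim : ∀ᵐ ω ∂Pr, Tendsto (fun n => F A n ω) atTop (𝓝 (f ω)) := by
    filter_upwards [ae_isLocallyFiniteInfinite h hlam, ae_encard_zero h,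
      ae_isRadiallySimple h hlam] with ω hS h0 hs
    have hval : ∀ n, F A n ω = if nthDist (φ ω) l ≤ R then Y ω * ∏ p ∈ Finset.Ico
        (ballCount (φ ω) (gridUp (1 / ((n : ℝ) + 1)) (nthDist (φ ω) l))) (ballCount (φ ω) R),
        ENNReal.ofReal (attenuation α β (nthDist (φ ω) 0)
          (gridUp (1 / ((n : ℝ) + 1)) (nthDist (φ ω) p))) else 0 := by
      intro n
      show ∑ k ∈ _, _ = _
      rw [sum_indicator_eq_ite]
      simp only [hiff]
      split_ifs with hl
      · have hp := prod_ring_eq_prod_rank hS (hδ n) (fun j => ENNReal.ofReal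
          (attenuation α β (nthDist (φ ω) 0) (j * (1 / ((n : ℝ) + 1))))) ((hiff n ω).2 hl)
        rw [hJ] at hp
        exact congrArg (Y ω * ·) hp
      · rfl
    simp_rw [hval, hf]
    split_ifs with hl
    · refine ENNReal.Tendsto.const_mul (tendsto_prod_gridUp hS h0 (hS.strictMono_nthDist h0 hs) hα hβ
        (nthDist_nonneg _ _) l _) (Or.inr (ne_top_of_le_ne_top ENNReal.one_ne_top (hY1 ω)))
    · exact tendsto_const_nhds
  have hBlim : ∀ᵐ ω ∂Pr, Tendsto (fun n => F B n ω) atTop (𝓝 (g ω)) := by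
    filter_upwards [ae_isLocallyFiniteInfinite h hlam, ae_encard_zero h] with ω hS h0
    have hval : ∀ n, F B n ω = if nthDist (φ ω) l ≤ R then Y ω * ENNReal.ofReal (Real.exp
        (-(2 * Real.pi * lam * ∫ u in (gridUp (1 / ((n : ℝ) + 1)) (nthDist (φ ω) l))..R,
        (1 - attenuation α β (nthDist (φ ω) 0) (gridUp (1 / ((n : ℝ) + 1)) u)) * u))) else 0 := by
      intro n
      show ∑ k ∈ _, _ = _
      rw [sum_indicator_eq_ite]
      simp only [hiff]
      split_ifs with hl
      · have hp := sum_ring_eq_integral (hδ n) (fun j => 1 - attenuation α β (nthDist (φ ω) 0)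
          (j * (1 / ((n : ℝ) + 1)))) ((hiff n ω).2 hl)
        rw [hJ] at hp
        refine congrArg (Y ω * ·) ?_
        rw [← ENNReal.ofReal_prod_of_nonneg fun _ _ => (Real.exp_pos _).le, ← Real.exp_sum]
        congr 2
        rw [Finset.sum_neg_distrib, neg_inj, mul_right_comm, mul_comm _ lam]
        refine Eq.trans ?_ (congrArg (lam * ·) hp)
        rw [Finset.mul_sum]
        exact Finset.sum_congr rfl fun j _ => mul_assoc _ _ _
      · rfl
    simp_rw [hval, hg]
    split_ifs with hl
    · refine ENNReal.Tendsto.const_mul (ENNReal.tendsto_ofReal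
        ((Real.continuous_exp.tendsto _).comp (Tendsto.neg (Tendsto.const_mul _ ?_))))
        (Or.inr (ne_top_of_le_ne_top ENNReal.one_ne_top (hY1 ω)))
      refine tendsto_integral_gridUp hα hβ (nthDist_nonneg _ _) (hS.nthDist_pos h0 l) hl fun n => ?_
      have := (hiff n ω).2 hl
      rw [← hJ n]
      exact mul_le_mul_of_nonneg_right (Nat.cast_le.2 this) (hδ n).le
    · exact tendsto_const_nhds
  refine ⟨aemeasurable_of_tendsto_metrizable_ae' (fun n => (hFm A hAm n).aemeasurable) hAlim,
    aemeasurable_of_tendsto_metrizable_ae' (fun n => (hFm B hBm n).aemeasurable) hBlim, ?_⟩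
  have hAint := tendsto_lintegral_of_dominated_convergence (fun _ => 1) (hFm A hAm)
    (fun n => Eventually.of_forall (hF1 A hA1 n)) (by simp) hAlim
  have hBint := tendsto_lintegral_of_dominated_convergence (fun _ => 1) (hFm B hBm)
    (fun n => Eventually.of_forall (hF1 B hB1 n)) (by simp) hBlim
  simp_rw [hFG] at hAint
  exact tendsto_nhds_unique hAint hBint

/-- The Laplace functional of the points of rank above `l`, given the points up to rank `l`. -/
theorem lintegral_mul_iInf_prod_attenuation (h : IsPoissonPointProcess Pr φ lam)
    [IsProbabilityMeasure Pr] (hlam : 0 < lam) (hR : 𝓡 ≤ mΩ) (hind : Indep (pointSigma φ) 𝓡 Pr)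
    {α β : ℝ} (hα : 2 < α) (hβ : 0 < β) {l : ℕ}
    {Y : Ω → ENNReal} (hY : Measurable[knownSigma φ 𝓡 l] Y) (hY1 : ∀ ω, Y ω ≤ 1) :
    ∫⁻ ω, Y ω * ⨅ n : ℕ, ∏ p ∈ Finset.Ico (l + 1) n,
      ENNReal.ofReal (attenuation α β (nthDist (φ ω) 0) (nthDist (φ ω) p)) ∂Pr =
    ∫⁻ ω, Y ω * ENNReal.ofReal (Real.exp (-(2 * Real.pi * lam *
      ∫ u in Set.Ioi (nthDist (φ ω) l), kernelFn α β (nthDist (φ ω) 0) u))) ∂Pr := by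
  have hα0 : 0 < α := by linarith
  let f : ℕ → Ω → ENNReal := fun R ω =>
    if nthDist (φ ω) l ≤ R then Y ω * ∏ p ∈ Finset.Ico (l + 1) (ballCount (φ ω) R),
      ENNReal.ofReal (attenuation α β (nthDist (φ ω) 0) (nthDist (φ ω) p)) else 0
  let g : ℕ → Ω → ENNReal := fun R ω =>
    if nthDist (φ ω) l ≤ R then Y ω * ENNReal.ofReal (Real.exp
      (-(2 * Real.pi * lam * ∫ u in (nthDist (φ ω) l)..R,
        (1 - attenuation α β (nthDist (φ ω) 0) u) * u))) else 0
  have hball := fun R => lintegral_mul_prod_attenuation_ball h hlam hR hind hα0 hβ R hY hY1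
    (f := f R) (g := g R) rfl rfl
  have hatt1 : ∀ ω p, ENNReal.ofReal (attenuation α β (nthDist (φ ω) 0) (nthDist (φ ω) p)) ≤ 1 :=
    fun ω p => by
      rw [ENNReal.ofReal_le_one]
      exact attenuation_le_one hβ (nthDist_nonneg _ _) (nthDist_nonneg _ _)
  have hf1 : ∀ R ω, f R ω ≤ 1 := by
    intro R ω
    simp only [f]
    split_ifs
    · exact mul_le_one' (hY1 ω) (Finset.prod_le_one' fun p _ => hatt1 ω p)
    · exact zero_le
  have hg1 : ∀ R ω, g R ω ≤ 1 := by
    intro R ω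
    simp only [g]
    split_ifs with hl
    · refine mul_le_one' (hY1 ω) ?_
      rw [ENNReal.ofReal_le_one, Real.exp_le_one_iff, neg_nonpos]
      have : 0 ≤ ∫ u in (nthDist (φ ω) l)..R, (1 - attenuation α β (nthDist (φ ω) 0) u) * u := by
        refine intervalIntegral.integral_nonneg hl fun u hu => ?_
        have hu0 := (nthDist_nonneg (φ ω) l).trans hu.1
        exact mul_nonneg (sub_nonneg.2 (attenuation_le_one hβ (nthDist_nonneg _ _) hu0)) hu0
      positivity
    · exact zero_le
  have hlarge : ∀ ω, ∀ᶠ R : ℕ in atTop, nthDist (φ ω) l ≤ R := fun ω =>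
    tendsto_natCast_atTop_atTop.eventually_ge_atTop _
  have hYt : ∀ ω, Y ω ≠ ⊤ := fun ω => ne_top_of_le_ne_top ENNReal.one_ne_top (hY1 ω)
  have hflim : ∀ᵐ ω ∂Pr, Tendsto (fun R => f R ω) atTop (𝓝 (Y ω * ⨅ n : ℕ,
      ∏ p ∈ Finset.Ico (l + 1) n,
        ENNReal.ofReal (attenuation α β (nthDist (φ ω) 0) (nthDist (φ ω) p)))) := by
    filter_upwards [ae_isLocallyFiniteInfinite h hlam] with ω hS
    have hcount : Tendsto (fun R : ℕ => ballCount (φ ω) R) atTop atTop := by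
      refine tendsto_atTop.2 fun k => ?_
      filter_upwards [tendsto_natCast_atTop_atTop.eventually_ge_atTop (nthDist (φ ω) k)] with R hk
      exact ((hS.lt_ballCount_iff R.cast_nonneg).2 hk).le
    -- All factors are at most 1, so the infimum over `n` is the limit of the partial products,
    -- along the counts in growing balls as well.
    have hanti : Antitone fun n : ℕ => ∏ p ∈ Finset.Ico (l + 1) n,
        ENNReal.ofReal (attenuation α β (nthDist (φ ω) 0) (nthDist (φ ω) p)) := fun m n hmn =>
      Finset.prod_le_prod_of_subset_of_le_one' (Finset.Ico_subset_Ico_right hmn)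
        fun p _ _ => hatt1 ω p
    refine (ENNReal.Tendsto.const_mul ((tendsto_atTop_iInf hanti).comp hcount)
      (Or.inr (hYt ω))).congr' ?_
    filter_upwards [hlarge ω] with R hl
    simp only [f, if_pos hl, Function.comp_apply]
  have hglim : ∀ᵐ ω ∂Pr, Tendsto (fun R => g R ω) atTop (𝓝 (Y ω * ENNReal.ofReal
      (Real.exp (-(2 * Real.pi * lam *
        ∫ u in Set.Ioi (nthDist (φ ω) l), kernelFn α β (nthDist (φ ω) 0) u))))) := by
    filter_upwards [ae_isLocallyFiniteInfinite h hlam, ae_encard_zero h] with ω hS h0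
    have hpos := hS.nthDist_pos h0
    have hint := intervalIntegral_tendsto_integral_Ioi (nthDist (φ ω) l)
      (integrableOn_kernelFn hα hβ (hpos 0) (hpos l)) tendsto_natCast_atTop_atTop
    refine (ENNReal.Tendsto.const_mul (ENNReal.tendsto_ofReal
      ((Real.continuous_exp.tendsto _).comp (Tendsto.neg (Tendsto.const_mul _ hint))))
      (Or.inr (hYt ω))).congr' ?_
    filter_upwards [hlarge ω] with R hl
    simp only [g, if_pos hl, Function.comp_apply]
    rw [intervalIntegral.integral_congr]
    intro u hu
    rw [Set.uIcc_of_le hl] at hu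
    exact (one_sub_attenuation_mul hβ (hpos 0) ((hpos l).trans_le hu.1)).symm
  have hfint := tendsto_lintegral_of_dominated_convergence' (fun _ => 1) (fun R => (hball R).1)
    (fun R => Eventually.of_forall (hf1 R)) (by simp) hflim
  have hgint := tendsto_lintegral_of_dominated_convergence' (fun _ => 1) (fun R => (hball R).2.1)
    (fun R => Eventually.of_forall (hg1 R)) (by simp) hglim
  simp_rw [fun R => (hball R).2.2] at hfint
  exact tendsto_nhds_unique hfint hgint

end Laplace

/-! ### Integrating out the fading, and dominance of the nearest station. -/

section Fading

variable {Ω : Type*} {𝓖 mΩ : MeasurableSpace Ω} {Pr : Measure Ω} {H : ℕ → Ω → ℝ} {μ : ℝ}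

/-- The σ-algebra generated by `𝓖` and all coefficients `H k` with `k ≠ j`. -/
@[reducible] def othersSigma (𝓖 : MeasurableSpace Ω) (H : ℕ → Ω → ℝ) (j : ℕ) : MeasurableSpace Ω :=
  𝓖 ⊔ ⨆ k : {k : ℕ // k ≠ j}, MeasurableSpace.comap (H k) inferInstance

theorem measurable_othersSigma (𝓖 : MeasurableSpace Ω) (H : ℕ → Ω → ℝ) {j k : ℕ} (hkj : k ≠ j) :
    Measurable[othersSigma 𝓖 H j] (H k) :=
  measurable_iff_comap_le.2 ((le_iSup (fun k : {k : ℕ // k ≠ j} =>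
    MeasurableSpace.comap (H k) inferInstance) ⟨k, hkj⟩).trans le_sup_right)

theorem othersSigma_le (hG : 𝓖 ≤ mΩ) (hH : ∀ k, Measurable (H k)) (j : ℕ) :
    othersSigma 𝓖 H j ≤ mΩ :=
  sup_le hG (iSup_le fun k => (hH k).comap_le)

/-- One coefficient is integrated out at a time, given `𝓖` and the others. Its Laplace transform `μ
/ (μ + a)` is `𝓖`-measurable and is absorbed into `Y`. -/
theorem lintegral_mul_prod_exp_fading [IsProbabilityMeasure Pr] (hμ : 0 < μ) (hG : 𝓖 ≤ mΩ)
    (hH : ∀ k, Measurable (H k)) (hlaw : ∀ k, Pr.map (H k) = expMeasure μ)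
    (hind : ∀ j, Indep (othersSigma 𝓖 H j) (MeasurableSpace.comap (H j) inferInstance) Pr)
    {a : ℕ → Ω → ℝ} (ha : ∀ k, Measurable[𝓖] (a k)) (ha0 : ∀ k ω, 0 ≤ a k ω) (s : Finset ℕ)
    {Y : Ω → ENNReal} (hY : Measurable[𝓖] Y) :
    ∫⁻ ω, Y ω * ∏ k ∈ s, ENNReal.ofReal (Real.exp (-(a k ω * H k ω))) ∂Pr =
      ∫⁻ ω, Y ω * ∏ k ∈ s, ENNReal.ofReal (μ / (μ + a k ω)) ∂Pr := by
  induction s using Finset.induction_on generalizing Y with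
  | empty => simp
  | insert j s hj ih =>
    have hle : 𝓖 ≤ othersSigma 𝓖 H j := le_sup_left
    have hmeas : Measurable[othersSigma 𝓖 H j] fun ω =>
        Y ω * ∏ k ∈ s, ENNReal.ofReal (Real.exp (-(a k ω * H k ω))) := by
      refine (hY.mono hle le_rfl).mul (Finset.measurable_fun_prod _ fun k hk => ?_)
      have hkj : k ≠ j := fun hkj => hj (hkj ▸ hk)
      exact Measurable.ennreal_ofReal (Real.measurable_exp.comp
        ((((ha k).mono hle le_rfl).mul (measurable_othersSigma 𝓖 H hkj)).neg))
    have hw : Measurable[𝓖] fun ω => ENNReal.ofReal (μ / (μ + a j ω)) :=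
      Measurable.ennreal_ofReal (measurable_const.div (measurable_const.add (ha j)))
    have hstep := lintegral_indep_eq_lintegral_lintegral
      (a := fun ω => (Y ω * ∏ k ∈ s, ENNReal.ofReal (Real.exp (-(a k ω * H k ω))), a j ω))
      (othersSigma_le hG hH j) (hH j) (hind j) (hmeas.prodMk ((ha j).mono hle le_rfl))
      (f := fun y x => y.1 * ENNReal.ofReal (Real.exp (-(y.2 * x)))) (by
        unfold Function.uncurry; fun_prop)
    have hinner : ∀ ω, ∫⁻ x, (Y ω * ∏ k ∈ s, ENNReal.ofReal (Real.exp (-(a k ω * H k ω)))) *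
        ENNReal.ofReal (Real.exp (-(a j ω * x))) ∂(Pr.map (H j)) =
        (Y ω * ∏ k ∈ s, ENNReal.ofReal (Real.exp (-(a k ω * H k ω)))) *
          ENNReal.ofReal (μ / (μ + a j ω)) := fun ω => by
      rw [lintegral_const_mul _ (by fun_prop), hlaw, lintegral_exp_neg_expMeasure hμ (ha0 j ω)]
    have hih := ih (hY.mul hw)
    simp only [Pi.mul_apply] at hih
    simp only [Finset.prod_insert hj]
    refine Eq.trans (lintegral_congr fun ω => ?_) (hstep.trans (Eq.trans
      (lintegral_congr fun ω => (hinner ω).trans ?_) (hih.trans (lintegral_congr fun ω => ?_))))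
    · rw [mul_assoc, mul_comm (ENNReal.ofReal _)]
    · rw [mul_right_comm]
    · rw [mul_assoc]

/-- Given `m`, the threshold `d` is a constant and the exponential tail beyond it is `exp (-μ d)`.
-/
theorem measure_inter_le_fading {m mΩ : MeasurableSpace Ω} {Pr : Measure Ω}
    [IsProbabilityMeasure Pr] (hμ : 0 < μ) (hm : m ≤ mΩ)
    {X : Ω → ℝ} (hX : Measurable X) (hlaw : Pr.map X = expMeasure μ)
    (hind : Indep m (MeasurableSpace.comap X inferInstance) Pr)
    {d : Ω → ℝ} (hd : Measurable[m] d) (hd0 : ∀ ω, 0 ≤ d ω) {G : Set Ω} (hG : MeasurableSet[m] G) :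
    Pr (G ∩ {ω | d ω ≤ X ω}) =
      ∫⁻ ω, G.indicator 1 ω * ENNReal.ofReal (Real.exp (-(μ * d ω))) ∂Pr := by
  have hdm : Measurable d := hd.mono hm le_rfl
  have hle : MeasurableSet {p : (ENNReal × ℝ) × ℝ | p.1.2 ≤ p.2} :=
    measurableSet_le (by fun_prop) (by fun_prop)
  have hind1 : Measurable[m] (G.indicator (1 : Ω → ENNReal)) := measurable_const.indicator hG
  have hstep := lintegral_indep_eq_lintegral_lintegral
    (a := fun ω => (G.indicator (1 : Ω → ENNReal) ω, d ω)) hm hX hind (hind1.prodMk hd)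
    (f := fun y x => y.1 * {p : (ENNReal × ℝ) × ℝ | p.1.2 ≤ p.2}.indicator 1 (y, x)) (by
      have h1 : Measurable ({p : (ENNReal × ℝ) × ℝ | p.1.2 ≤ p.2}.indicator
          (1 : (ENNReal × ℝ) × ℝ → ENNReal)) := measurable_const.indicator hle
      exact (measurable_fst.comp measurable_fst).mul h1)
  refine Eq.trans ?_ (hstep.trans (lintegral_congr fun ω => ?_))
  · rw [← lintegral_indicator_one ((hm _ hG).inter (measurableSet_le hdm hX))]
    refine lintegral_congr fun ω => ?_
    rw [Set.inter_indicator_one]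
    rfl
  · have hset : (fun x : ℝ => {p : (ENNReal × ℝ) × ℝ | p.1.2 ≤ p.2}.indicator
        (1 : (ENNReal × ℝ) × ℝ → ENNReal)
        ((G.indicator (1 : Ω → ENNReal) ω, d ω), x)) = (Set.Ici (d ω)).indicator 1 := by
      ext x
      simp [Set.indicator_apply]
    have hset' : Measurable ((Set.Ici (d ω)).indicator (1 : ℝ → ENNReal)) :=
      measurable_const.indicator measurableSet_Ici
    rw [lintegral_const_mul _ (by rw [hset]; exact hset'), hset,
      lintegral_indicator_one measurableSet_Ici, hlaw, expMeasure_Ici hμ (hd0 ω)]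

/-- Noise and interference of the `n` strongest stations, in units of the received power of the
station of rank `j` at unit fading, times the threshold. -/
noncomputable def requiredFading (α β c : ℝ) (r : ℕ → ℝ) (x : ℕ → ℝ) (j n : ℕ) : ℝ :=
  c * r j ^ α + ∑ k ∈ (Finset.range n).erase j, β * (r j / r k) ^ α * max (x k) 0

/-- Conditional coverage probability of the station of rank `j`, given all distances `r`. -/
noncomputable def coverGivenDistances (α β μ c : ℝ) (r : ℕ → ℝ) (j : ℕ) : ENNReal :=
  ⨅ n : ℕ, ENNReal.ofReal (Real.exp (-(μ * (c * r j ^ α)))) *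
    ∏ k ∈ (Finset.range n).erase j, ENNReal.ofReal (attenuation α β (r j) (r k))

/-- For finitely many interferers the tail of the serving fading has the form `exp` of minus a sum,
so the interference factorizes into Laplace transforms. The events decrease as interferers are
added, so continuity from above gives the full statement without any convergence of the
interference. -/
theorem measure_inter_forall_requiredFading_le [IsProbabilityMeasure Pr] (hμ : 0 < μ)
    (hG : 𝓖 ≤ mΩ)
    (hH : ∀ k, Measurable (H k)) (hlaw : ∀ k, Pr.map (H k) = expMeasure μ)
    (hind : ∀ j, Indep (othersSigma 𝓖 H j) (MeasurableSpace.comap (H j) inferInstance) Pr)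
    {α β c : ℝ} (hβ : 0 < β) (hc : 0 ≤ c)
    {r : ℕ → Ω → ℝ} (hr : ∀ k, Measurable[𝓖] (r k)) (hr0 : ∀ k ω, 0 ≤ r k ω)
    (hpos : ∀ᵐ ω ∂Pr, ∀ k, 0 < H k ω) (j : ℕ) {G : Set Ω} (hGm : MeasurableSet[𝓖] G) :
    Pr (G ∩ {ω | ∀ n, requiredFading α β c (fun k => r k ω) (fun k => H k ω) j n ≤ H j ω}) =
      ∫⁻ ω, G.indicator 1 ω * coverGivenDistances α β μ c (fun k => r k ω) j ∂Pr := by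
  let D : ℕ → Ω → ℝ := fun n ω =>
    requiredFading α β c (fun k => r k ω) (fun k => H k ω) j n
  have hle : 𝓖 ≤ othersSigma 𝓖 H j := le_sup_left
  have hb0 : ∀ k ω, 0 ≤ β * (r j ω / r k ω) ^ α := fun k ω =>
    mul_nonneg hβ.le (Real.rpow_nonneg (div_nonneg (hr0 j ω) (hr0 k ω)) α)
  have hc0 : ∀ ω, 0 ≤ c * r j ω ^ α := fun ω => mul_nonneg hc (Real.rpow_nonneg (hr0 j ω) α)
  have hD0 : ∀ n ω, 0 ≤ D n ω := fun n ω =>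
    add_nonneg (hc0 ω) (Finset.sum_nonneg fun k _ => mul_nonneg (hb0 k ω) (le_max_right _ _))
  have hbm : ∀ k, Measurable[𝓖] fun ω => β * (r j ω / r k ω) ^ α := fun k =>
    (((hr j).div (hr k)).pow measurable_const).const_mul β
  have hcm : Measurable[𝓖] fun ω => c * r j ω ^ α :=
    ((hr j).pow measurable_const).const_mul c
  have hDm : ∀ n, Measurable[othersSigma 𝓖 H j] (D n) := fun n => by
    refine (hcm.mono hle le_rfl).add (Finset.measurable_fun_sum _ fun k hk => ?_)
    exact ((hbm k).mono hle le_rfl).mul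
      ((measurable_othersSigma 𝓖 H (Finset.ne_of_mem_erase hk)).max measurable_const)
  -- The positive part in `requiredFading` makes this hold for every `ω`; it disappears almost
  -- everywhere by `hpos`.
  have hmono : ∀ ω, Monotone fun n => D n ω := fun ω m n hmn =>
    add_le_add_right (Finset.sum_le_sum_of_subset_of_nonneg
      (Finset.erase_subset_erase _ (Finset.range_mono hmn))
      fun k _ _ => mul_nonneg (hb0 k ω) (le_max_right _ _)) _
  have hDmΩ : ∀ n, Measurable (D n) := fun n => (hDm n).mono (othersSigma_le hG hH j) le_rfl
  have hYm : Measurable[𝓖] fun ω =>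
      G.indicator (1 : Ω → ENNReal) ω * ENNReal.ofReal (Real.exp (-(μ * (c * r j ω ^ α)))) :=
    (measurable_const.indicator hGm).mul
      (Measurable.ennreal_ofReal (Real.measurable_exp.comp (hcm.const_mul μ).neg))
  have hone : ∀ n, Pr (G ∩ {ω | D n ω ≤ H j ω}) =
      ∫⁻ ω, G.indicator 1 ω * (ENNReal.ofReal (Real.exp (-(μ * (c * r j ω ^ α)))) *
        ∏ k ∈ (Finset.range n).erase j, ENNReal.ofReal (attenuation α β (r j ω) (r k ω))) ∂Pr := by
    intro n
    rw [measure_inter_le_fading hμ (othersSigma_le hG hH j) (hH j) (hlaw j) (hind j) (hDm n)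
      (hD0 n) (hle _ hGm)]
    have hpeel := lintegral_mul_prod_exp_fading hμ hG hH hlaw hind
      (a := fun k ω => μ * (β * (r j ω / r k ω) ^ α)) (fun k => (hbm k).const_mul μ)
      (fun k ω => mul_nonneg hμ.le (hb0 k ω)) ((Finset.range n).erase j) hYm
    refine Eq.trans (lintegral_congr_ae ?_) (hpeel.trans (lintegral_congr fun ω => ?_))
    · filter_upwards [hpos] with ω hω
      rw [mul_assoc]
      congr 1
      rw [← ENNReal.ofReal_prod_of_nonneg fun _ _ => (Real.exp_pos _).le,
        ← ENNReal.ofReal_mul (Real.exp_pos _).le, ← Real.exp_sum, ← Real.exp_add]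
      congr 2
      simp only [D, requiredFading]
      rw [mul_add, neg_add, Finset.mul_sum, Finset.sum_neg_distrib]
      congr 2
      refine Finset.sum_congr rfl fun k _ => ?_
      rw [max_eq_left (hω k).le]
      ring
    · rw [mul_assoc]
      congr 2
      refine Finset.prod_congr rfl fun k _ => ?_
      congr 1
      rw [attenuation]
      have := hb0 k ω
      field_simp
  have hset : G ∩ {ω | ∀ n, D n ω ≤ H j ω} = ⋂ n, G ∩ {ω | D n ω ≤ H j ω} := by
    rw [← Set.inter_iInter]
    congr 1
    ext ω
    simp
  show Pr (G ∩ {ω | ∀ n, D n ω ≤ H j ω}) = _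
  have hanti : Antitone fun n => G ∩ {ω | D n ω ≤ H j ω} := fun m n hmn =>
    Set.inter_subset_inter_right _ fun ω hω => (hmono ω hmn).trans hω
  rw [hset, hanti.measure_iInter
    (fun n => ((hG _ hGm).inter (measurableSet_le (hDmΩ n) (hH j))).nullMeasurableSet)
    ⟨0, measure_ne_top _ _⟩]
  simp_rw [hone]
  have hatt1 : ∀ k ω, ENNReal.ofReal (attenuation α β (r j ω) (r k ω)) ≤ 1 := fun k ω => by
    rw [ENNReal.ofReal_le_one]
    exact attenuation_le_one hβ (hr0 j ω) (hr0 k ω)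
  have hrm : ∀ k, Measurable (r k) := fun k => (hr k).mono hG le_rfl
  have hind1 : Measurable (G.indicator (1 : Ω → ENNReal)) := measurable_const.indicator (hG _ hGm)
  have hexp1 : ∀ ω, ENNReal.ofReal (Real.exp (-(μ * (c * r j ω ^ α)))) ≤ 1 := fun ω => by
    rw [ENNReal.ofReal_le_one, Real.exp_le_one_iff, neg_nonpos]
    exact mul_nonneg hμ.le (hc0 ω)
  rw [← lintegral_iInf]
  · refine lintegral_congr fun ω => ?_
    rw [coverGivenDistances]
    by_cases hω : ω ∈ G <;> simp [hω]
  · intro n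
    have hrj := hrm j
    fun_prop
  · intro m n hmn ω
    refine mul_le_mul_right (mul_le_mul_right ?_ _) _
    exact Finset.prod_le_prod_of_subset_of_le_one'
      (Finset.erase_subset_erase _ (Finset.range_mono hmn)) fun k _ _ => hatt1 k ω
  · refine ne_top_of_le_ne_top ENNReal.one_ne_top ?_
    calc _ ≤ ∫⁻ ω, 1 ∂Pr := by
          refine lintegral_mono fun ω => mul_le_one' ?_ (mul_le_one' (hexp1 ω)
            (Finset.prod_le_one' fun k _ => hatt1 k ω))
          exact Set.indicator_le_self' (fun _ _ => zero_le) ω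
      _ = 1 := by simp

/-- Moving the server from rank `j` to rank 0 raises the noise factor and the factor of every third
station, both by monotonicity in the server distance. The two stations exchange roles as
interferers, and `r 0 / r j ≤ r j / r 0` settles that factor. -/
theorem coverGivenDistances_le_zero {α β c : ℝ} (hα : 0 < α) (hβ : 0 < β) (hμ : 0 < μ)
    (hc : 0 ≤ c) {r : ℕ → ℝ} (hr : ∀ k, 0 < r k) (hmono : Monotone r) (j : ℕ) :
    coverGivenDistances α β μ c r j ≤ coverGivenDistances α β μ c r 0 := by
  rcases eq_or_ne j 0 with rfl | hj
  · exact le_rfl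
  refine le_iInf fun n => ?_
  -- The truncation must contain both ranks 0 and `j` for their factors to be exchanged.
  refine (iInf_le _ (max n (j + 1))).trans ?_
  set M := max n (j + 1)
  have hjM : j ∈ Finset.range M := Finset.mem_range.2 (lt_of_lt_of_le (Nat.lt_succ_self j)
    (le_max_right _ _))
  have h0M : 0 ∈ Finset.range M := Finset.mem_range.2 ((Nat.succ_pos j).trans_le (le_max_right _ _))
  have hpow : r 0 ^ α ≤ r j ^ α := Real.rpow_le_rpow (hr 0).le (hmono (Nat.zero_le j)) hα.le
  refine mul_le_mul' (ENNReal.ofReal_le_ofReal (Real.exp_le_exp.2 (neg_le_neg (by gcongr)))) ?_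
  calc ∏ k ∈ (Finset.range M).erase j, ENNReal.ofReal (attenuation α β (r j) (r k))
      = ENNReal.ofReal (attenuation α β (r j) (r 0)) *
          ∏ k ∈ ((Finset.range M).erase j).erase 0, ENNReal.ofReal (attenuation α β (r j) (r k)) :=
        (Finset.mul_prod_erase _ _ (Finset.mem_erase.2 ⟨hj.symm, h0M⟩)).symm
    _ ≤ ENNReal.ofReal (attenuation α β (r 0) (r j)) *
          ∏ k ∈ ((Finset.range M).erase 0).erase j,
            ENNReal.ofReal (attenuation α β (r 0) (r k)) := by
        rw [Finset.erase_right_comm]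
        refine mul_le_mul' (ENNReal.ofReal_le_ofReal ?_)
          (Finset.prod_le_prod' fun k _ => ENNReal.ofReal_le_ofReal
            (attenuation_anti hα hβ (hr 0).le (hr k) (hmono (Nat.zero_le j))))
        unfold attenuation
        have h1 : (r 0 / r j) ^ α ≤ (r j / r 0) ^ α :=
          Real.rpow_le_rpow (div_nonneg (hr 0).le (hr j).le)
            (((div_le_one (hr j)).2 (hmono (Nat.zero_le j))).trans
              ((one_le_div (hr 0)).2 (hmono (Nat.zero_le j)))) hα.le
        have h2 := Real.rpow_nonneg (div_nonneg (hr 0).le (hr j).le) α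
        gcongr
    _ = ∏ k ∈ (Finset.range M).erase 0, ENNReal.ofReal (attenuation α β (r 0) (r k)) :=
        Finset.mul_prod_erase _ (fun k => ENNReal.ofReal (attenuation α β (r 0) (r k)))
          (Finset.mem_erase.2 ⟨hj, hjM⟩)
    _ ≤ ∏ k ∈ (Finset.range n).erase 0, ENNReal.ofReal (attenuation α β (r 0) (r k)) := by
        refine Finset.prod_le_prod_of_subset_of_le_one'
          (Finset.erase_subset_erase _ (Finset.range_mono (le_max_left _ _))) fun k _ _ => ?_
        rw [ENNReal.ofReal_le_one]
        exact attenuation_le_one hβ (hr 0).le (hr k).le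

end Fading

/-! ### Policies, scores and measurable maximizers. -/

section Decision

variable {T : ℕ} {Ω : Type*} {𝓕 mΩ : MeasurableSpace Ω} {Pr : Measure Ω}

/-- The event that the station chosen by `π` covers the user. -/
def chosenEvent (C : Fin T → ℕ → Set Ω) (π : Ω → Fin T × ℕ) : Set Ω :=
  {ω | ω ∈ C (π ω).1 (π ω).2}

theorem lintegral_eq_tsum_policy {π : Ω → Fin T × ℕ} (hπ : Measurable π) (f : Ω → ENNReal) :
    ∫⁻ ω, f ω ∂Pr = ∑' p, ∫⁻ ω in π ⁻¹' {p}, f ω ∂Pr := by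
  rw [← lintegral_iUnion (fun p => hπ (measurableSet_singleton p))
    (fun p q hpq => (Set.disjoint_singleton.2 hpq).preimage π), ← Set.preimage_iUnion,
    Set.iUnion_of_singleton, Set.preimage_univ, setLIntegral_univ]

theorem chosenEvent_inter (C : Fin T → ℕ → Set Ω) (π : Ω → Fin T × ℕ) (p : Fin T × ℕ) :
    chosenEvent C π ∩ π ⁻¹' {p} = π ⁻¹' {p} ∩ C p.1 p.2 := by
  ext ω
  simp only [chosenEvent, Set.mem_inter_iff, Set.mem_ofPred_eq, Set.mem_preimage,
    Set.mem_singleton_iff]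
  constructor
  · rintro ⟨h, rfl⟩
    exact ⟨rfl, h⟩
  · rintro ⟨rfl, h⟩
    exact ⟨h, rfl⟩

theorem measurableSet_chosenEvent {C : Fin T → ℕ → Set Ω} (hC : ∀ i j, MeasurableSet (C i j))
    {π : Ω → Fin T × ℕ} (hπ : Measurable π) : MeasurableSet (chosenEvent C π) := by
  have : chosenEvent C π = ⋃ p, chosenEvent C π ∩ π ⁻¹' {p} := by
    rw [← Set.inter_iUnion, ← Set.preimage_iUnion, Set.iUnion_of_singleton, Set.preimage_univ,
      Set.inter_univ]
  rw [this]
  refine MeasurableSet.iUnion fun p => ?_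
  rw [chosenEvent_inter]
  exact (hπ (measurableSet_singleton p)).inter (hC _ _)

theorem measure_chosenEvent {C : Fin T → ℕ → Set Ω} (hC : ∀ i j, MeasurableSet (C i j))
    {π : Ω → Fin T × ℕ} (hπ : Measurable π) :
    Pr (chosenEvent C π) = ∑' p, Pr (π ⁻¹' {p} ∩ C p.1 p.2) := by
  have hE := measurableSet_chosenEvent hC hπ
  rw [← lintegral_indicator_one hE, lintegral_eq_tsum_policy hπ]
  refine tsum_congr fun p => ?_
  rw [lintegral_indicator_one hE, Measure.restrict_apply hE, chosenEvent_inter]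

theorem setLIntegral_policy {s : Fin T → Ω → ℝ} {π : Ω → Fin T × ℕ} (hπ : Measurable π)
    (p : Fin T × ℕ) : ∫⁻ ω in π ⁻¹' {p}, ENNReal.ofReal (s p.1 ω) ∂Pr =
      ∫⁻ ω in π ⁻¹' {p}, ENNReal.ofReal (s (π ω).1 ω) ∂Pr :=
  setLIntegral_congr_fun (hπ (measurableSet_singleton p)) fun ω (hω : π ω = p) => by
    simp only [hω]

/-- A policy takes countably many values, and on each of the resulting events of `𝓕` it uses one
fixed station, so the domination and the score formula apply piece by piece. -/
theorem measure_chosenEvent_le (hF : 𝓕 ≤ mΩ) {C : Fin T → ℕ → Set Ω}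
    (hC : ∀ i j, MeasurableSet (C i j)) {s : Fin T → Ω → ℝ}
    (hscore : ∀ i A, MeasurableSet[𝓕] A →
      Pr (A ∩ C i 0) = ∫⁻ ω in A, ENNReal.ofReal (s i ω) ∂Pr)
    (hdom : ∀ i j A, MeasurableSet[𝓕] A → Pr (A ∩ C i j) ≤ Pr (A ∩ C i 0))
    {π : Ω → Fin T × ℕ} (hπ : Measurable[𝓕] π) :
    Pr (chosenEvent C π) ≤ ∫⁻ ω, ENNReal.ofReal (s (π ω).1 ω) ∂Pr := by
  have hπm := hπ.mono hF le_rfl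
  rw [measure_chosenEvent hC hπm, lintegral_eq_tsum_policy hπm]
  refine ENNReal.tsum_le_tsum fun p => ?_
  have hA := hπ (measurableSet_singleton p)
  rw [← setLIntegral_policy hπm, ← hscore _ _ hA]
  exact hdom _ _ _ hA

theorem measure_chosenEvent_eq (hF : 𝓕 ≤ mΩ) {C : Fin T → ℕ → Set Ω}
    (hC : ∀ i j, MeasurableSet (C i j)) {s : Fin T → Ω → ℝ}
    (hscore : ∀ i A, MeasurableSet[𝓕] A →
      Pr (A ∩ C i 0) = ∫⁻ ω in A, ENNReal.ofReal (s i ω) ∂Pr)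
    {π : Ω → Fin T × ℕ} (hπ : Measurable[𝓕] π) (hπ0 : ∀ᵐ ω ∂Pr, (π ω).2 = 0) :
    Pr (chosenEvent C π) = ∫⁻ ω, ENNReal.ofReal (s (π ω).1 ω) ∂Pr := by
  have hπm := hπ.mono hF le_rfl
  rw [measure_chosenEvent hC hπm, lintegral_eq_tsum_policy hπm]
  refine tsum_congr fun p => ?_
  have hA := hπ (measurableSet_singleton p)
  rcases eq_or_ne p.2 0 with hp | hp
  · rw [← setLIntegral_policy hπm, ← hscore _ _ hA, hp]
  · have hnull : Pr (π ⁻¹' {p}) = 0 := by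
      refine measure_mono_null (fun ω (hω : π ω = p) => ?_) (ae_iff.1 hπ0)
      rw [Set.mem_ofPred_eq, hω]
      exact hp
    rw [setLIntegral_measure_zero _ _ hnull]
    exact measure_mono_null Set.inter_subset_left hnull

/-- Ties are broken by the least maximizing index, so each preimage is a finite combination of
comparison events. -/
theorem exists_measurable_argmax (hT : 0 < T) {m : MeasurableSpace Ω}
    {s : Fin T → Ω → ℝ} (hs : ∀ i, Measurable (s i)) :
    ∃ f : Ω → Fin T, Measurable f ∧ ∀ ω i, s i ω ≤ s (f ω) ω := by
  have hne : Nonempty (Fin T) := ⟨⟨0, hT⟩⟩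
  let S : Ω → Set (Fin T) := fun ω => {i | ∀ l, s l ω ≤ s i ω}
  have hex : ∀ ω, ∃ i ∈ S ω, ∀ j ∈ S ω, ¬ j < i := fun ω => by
    refine WellFounded.has_min wellFounded_lt (S ω) ?_
    obtain ⟨i, -, hi⟩ := Finset.exists_max_image Finset.univ (fun i => s i ω) Finset.univ_nonempty
    exact ⟨i, fun l => hi l (Finset.mem_univ l)⟩
  choose f hfS hfmin using hex
  have hSm : ∀ i, MeasurableSet {ω | i ∈ S ω} := fun i => by
    have : {ω | i ∈ S ω} = ⋂ l, {ω | s l ω ≤ s i ω} := by ext; simp [S]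
    rw [this]
    exact MeasurableSet.iInter fun l => measurableSet_le (hs l) (hs i)
  have hf : Measurable f := by
    refine measurable_to_countable' fun i => ?_
    have : f ⁻¹' {i} = {ω | i ∈ S ω} ∩ ⋂ j : {j // j < i}, {ω | j.1 ∈ S ω}ᶜ := by
      ext ω
      simp only [Set.mem_preimage, Set.mem_singleton_iff, Set.mem_inter_iff, Set.mem_ofPred_eq,
        Set.mem_iInter, Set.mem_compl_iff, Subtype.forall]
      constructor
      · rintro rfl
        exact ⟨hfS ω, fun j hj hjS => hfmin ω j hjS hj⟩
      · rintro ⟨hi, hmin⟩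
        exact le_antisymm (not_lt.1 (hfmin ω i hi)) (not_lt.1 fun hlt => hmin _ hlt (hfS ω))
    rw [this]
    exact (hSm i).inter (MeasurableSet.iInter fun j => (hSm j).compl)
  exact ⟨f, hf, hfS⟩

theorem exists_policy_followsRule (hT : 0 < T) {𝓕 mΩ : MeasurableSpace Ω} {Pr : Measure Ω}
    {s : Fin T → Ω → ℝ} (hs : ∀ i, Measurable[𝓕] (s i)) :
    ∃ π : Ω → Fin T × ℕ, Measurable[𝓕] π ∧ FollowsRule Pr s π := by
  obtain ⟨f, hf, hfs⟩ := exists_measurable_argmax hT hs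
  exact ⟨fun ω => (f ω, 0), hf.prodMk measurable_const,
    Eventually.of_forall fun ω => ⟨hfs ω, rfl⟩⟩

theorem condExp_indicator_eq_score [IsProbabilityMeasure Pr] (hF : 𝓕 ≤ mΩ) {C : Set Ω}
    (hC : MeasurableSet C) {s : Ω → ℝ} (hs : Measurable[𝓕] s) (hs0 : ∀ ω, 0 ≤ s ω)
    (hscore : ∀ A, MeasurableSet[𝓕] A → Pr (A ∩ C) = ∫⁻ ω in A, ENNReal.ofReal (s ω) ∂Pr) :
    Pr[C.indicator (1 : Ω → ℝ) | 𝓕] =ᵐ[Pr] s := by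
  have hsm : Measurable s := hs.mono hF le_rfl
  have hint : Integrable s Pr := by
    refine ⟨hsm.aestronglyMeasurable, ?_⟩
    rw [hasFiniteIntegral_iff_ofReal (Eventually.of_forall hs0), ← setLIntegral_univ,
      ← hscore _ MeasurableSet.univ]
    exact measure_lt_top _ _
  refine (ae_eq_condExp_of_forall_setIntegral_eq hF
    ((show Integrable (1 : Ω → ℝ) Pr from integrable_const 1).indicator hC) (fun A _ _ => hint.integrableOn)
    (fun A hA _ => ?_) hs.aestronglyMeasurable).symm
  rw [integral_eq_lintegral_of_nonneg_ae (Eventually.of_forall hs0)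
    hsm.aestronglyMeasurable, ← hscore A hA,
    integral_indicator_one hC, measureReal_def,
    Measure.restrict_apply hC, Set.inter_comm]

/-- Tower property: a version already measurable for the coarser σ-algebra is a version there too.
Thus conditioning on one technology alone follows from conditioning on the full information. -/
theorem condExp_eq_of_le {m 𝓕 mΩ : MeasurableSpace Ω} {Pr : Measure Ω} [IsProbabilityMeasure Pr]
    (hm : m ≤ 𝓕) (hF : 𝓕 ≤ mΩ) {f s : Ω → ℝ} (hs : Measurable[m] s)
    (h : Pr[f | 𝓕] =ᵐ[Pr] s) : Pr[f | m] =ᵐ[Pr] s := by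
  have hint : Integrable s Pr := integrable_condExp.congr h
  calc Pr[f | m] =ᵐ[Pr] Pr[Pr[f | 𝓕] | m] := (condExp_condExp_of_le hm hF).symm
    _ =ᵐ[Pr] Pr[s | m] := condExp_congr_ae h
    _ = s := condExp_of_stronglyMeasurable (hm.trans hF) hs.stronglyMeasurable hint

end Decision

/-! ### Assembly for the network. -/

namespace Network

variable {T : ℕ} {Ω : Type*} (N : Network T Ω)

/-- The coverage event of the station of rank `j` of technology `i`. -/
def coverEvent (i : Fin T) (j : ℕ) : Set Ω :=
  {ω | ENNReal.ofReal (N.threshold i) ≤ N.sinr i j ω}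

/-- Conditional coverage probability of the nearest station of technology `i`, given the distances
to the `l + 1` nearest stations. -/
noncomputable def score (l : ℕ) (i : Fin T) (ω : Ω) : ℝ :=
  Real.exp (-(N.μ * (N.threshold i * N.noise i / N.power i * N.dist i 0 ω ^ N.α))) *
    (∏ k ∈ Finset.Ico 1 (l + 1), attenuation N.α (N.threshold i) (N.dist i 0 ω) (N.dist i k ω)) *
    Real.exp (-(2 * Real.pi * N.intensity i *
      ∫ u in Set.Ioi (N.dist i l ω), kernelFn N.α (N.threshold i) (N.dist i 0 ω) u))

theorem score_zero : N.score 0 = N.scoreOne := by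
  funext i ω
  simp only [score, scoreOne, coverExprOne, zero_add, Finset.Ico_self, Finset.prod_empty, mul_one]
  congr 3
  ring

theorem score_one : N.score 1 = N.scoreTwo := by
  funext i ω
  simp only [score, scoreTwo, coverExprTwo, attenuation]
  norm_num
  left
  ring

theorem measurable_score_of_dist {m : MeasurableSpace Ω} {l : ℕ} {i : Fin T}
    (h : ∀ k ≤ l, Measurable (N.dist i k)) : Measurable (N.score l i) := by
  have h0 := h 0 (Nat.zero_le l)
  have hl := h l le_rfl
  have hint : Measurable fun p : ℝ × ℝ =>
      ∫ u in Set.Ioi p.2, kernelFn N.α (N.threshold i) p.1 u := by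
    simp_rw [← integral_indicator (measurableSet_Ioi (α := ℝ))]
    have hset : MeasurableSet {q : (ℝ × ℝ) × ℝ | q.1.2 < q.2} :=
      measurableSet_lt (by fun_prop) (by fun_prop)
    have hj : Measurable ({q : (ℝ × ℝ) × ℝ | q.1.2 < q.2}.indicator
        fun q => kernelFn N.α (N.threshold i) q.1.1 q.2) :=
      Measurable.indicator (by fun_prop) hset
    exact (hj.stronglyMeasurable.integral_prod_right' (ν := volume)).measurable
  unfold score
  refine Measurable.mul (Measurable.mul (by fun_prop)
    (Finset.measurable_fun_prod _ fun k hk => ?_)) ?_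
  · exact measurable_attenuation h0 (h k (Nat.lt_succ_iff.1 (Finset.mem_Ico.1 hk).2))
  · have := hint.comp (h0.prodMk hl)
    exact Real.measurable_exp.comp (this.const_mul _).neg

theorem measurable_weight_of_dist {m : MeasurableSpace Ω} {l : ℕ} {i : Fin T} {c : ℝ}
    (h : ∀ k ≤ l, Measurable (N.dist i k)) : Measurable fun ω =>
      ENNReal.ofReal (Real.exp (-(N.μ * (c * N.dist i 0 ω ^ N.α)))) *
        ∏ k ∈ Finset.Ico 1 (l + 1),
          ENNReal.ofReal (attenuation N.α (N.threshold i) (N.dist i 0 ω) (N.dist i k ω)) := by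
  have h0 := h 0 (Nat.zero_le l)
  refine Measurable.mul (by fun_prop) (Finset.measurable_fun_prod _ fun k hk => ?_)
  exact (measurable_attenuation h0
    (h k (Nat.lt_succ_iff.1 (Finset.mem_Ico.1 hk).2))).ennreal_ofReal

theorem measurable_dist_techInfo {L k : ℕ} (hk : k < L) (i : Fin T) :
    Measurable[N.techInfo L i] (N.dist i k) :=
  measurable_iff_comap_le.2 (le_iSup (fun k : Fin L =>
    MeasurableSpace.comap (N.dist i k) inferInstance) ⟨k, hk⟩)

theorem measurable_score_techInfo (l : ℕ) (i : Fin T) :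
    Measurable[N.techInfo (l + 1) i] (N.score l i) :=
  N.measurable_score_of_dist fun _ hk => N.measurable_dist_techInfo (Nat.lt_succ_of_le hk) i

theorem measurable_score_info (l : ℕ) (𝓤 : MeasurableSpace Ω) (i : Fin T) :
    Measurable[N.info (l + 1) ⊔ 𝓤] (N.score l i) :=
  (N.measurable_score_techInfo l i).mono ((le_iSup (N.techInfo (l + 1)) i).trans le_sup_left) le_rfl

theorem score_nonneg (hβ : ∀ i, 0 < N.threshold i) (l : ℕ) (i : Fin T) (ω : Ω) :
    0 ≤ N.score l i ω :=
  mul_nonneg (mul_nonneg (Real.exp_pos _).le (Finset.prod_nonneg fun _ _ =>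
    attenuation_nonneg (hβ i) (nthDist_nonneg _ _) (nthDist_nonneg _ _))) (Real.exp_pos _).le

/-- The information on all stations, together with `𝓤`. -/
@[reducible] noncomputable def stationSigma (𝓤 : MeasurableSpace Ω) : MeasurableSpace Ω :=
  (⨆ i, pointSigma (N.stations i)) ⊔ 𝓤

/-- The information on the stations of all technologies except `i`, together with `𝓤`. -/
@[reducible] noncomputable def otherStationSigma (𝓤 : MeasurableSpace Ω) (i : Fin T) : MeasurableSpace Ω :=
  (⨆ l : {l : Fin T // l ≠ i}, pointSigma (N.stations l)) ⊔ 𝓤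

theorem techInfo_le_pointSigma (L : ℕ) (i : Fin T) : N.techInfo L i ≤ pointSigma (N.stations i) :=
  iSup_le fun k => (measurable_nthDist (N.stations i) k).comap_le

theorem info_le_stationSigma (L : ℕ) (𝓤 : MeasurableSpace Ω) :
    N.info L ⊔ 𝓤 ≤ N.stationSigma 𝓤 :=
  sup_le_sup_right (iSup_mono fun i => N.techInfo_le_pointSigma L i) 𝓤

/-- From the viewpoint of technology `i`, the other technologies and `𝓤` form the independent
external source `𝓡`, while its own distances are the stopped information. -/
theorem info_le_knownSigma (l : ℕ) (𝓤 : MeasurableSpace Ω) (i : Fin T) :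
    N.info (l + 1) ⊔ 𝓤 ≤ knownSigma (N.stations i) (N.otherStationSigma 𝓤 i) l := by
  refine sup_le (iSup_le fun i' => ?_) (le_sup_right.trans le_sup_right)
  rcases eq_or_ne i' i with rfl | hi
  · exact le_sup_left
  · exact (N.techInfo_le_pointSigma _ _).trans ((le_iSup (fun l : {l : Fin T // l ≠ i} =>
      pointSigma (N.stations l)) ⟨i', hi⟩).trans (le_sup_left.trans le_sup_right))

section Random

variable {𝓤 mΩ : MeasurableSpace Ω} {Pr : Measure Ω}

theorem sourceSigma_le (hN : N.IsPoissonRayleigh Pr) (s : Fin T ⊕ (Fin T × ℕ)) :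
    N.sourceSigma s ≤ mΩ := by
  rcases s with i | ⟨i, k⟩
  · exact pointSigma_le (hN.stations_ppp i)
  · exact (hN.fading_measurable i k).comap_le

theorem stationSigma_le (hN : N.IsPoissonRayleigh Pr) (h𝓤 : 𝓤 ≤ mΩ) : N.stationSigma 𝓤 ≤ mΩ :=
  sup_le (iSup_le fun i => pointSigma_le (hN.stations_ppp i)) h𝓤

theorem otherStationSigma_le (hN : N.IsPoissonRayleigh Pr) (h𝓤 : 𝓤 ≤ mΩ) (i : Fin T) :
    N.otherStationSigma 𝓤 i ≤ mΩ :=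
  sup_le (iSup_le fun l => pointSigma_le (hN.stations_ppp l)) h𝓤

/-- Each source is independent of all other sources together with `𝓤`. -/
theorem indep_source [IsProbabilityMeasure Pr] (hN : N.IsPoissonRayleigh Pr) (h𝓤 : 𝓤 ≤ mΩ)
    (h𝓤N : Indep 𝓤 (⨆ s, N.sourceSigma s) Pr) (s : Fin T ⊕ (Fin T × ℕ)) :
    Indep ((⨆ s' ∈ ({s}ᶜ : Set (Fin T ⊕ (Fin T × ℕ))), N.sourceSigma s') ⊔ 𝓤)
      (N.sourceSigma s) Pr := by
  have hind := indep_iSup_of_disjoint (m := N.sourceSigma) (N.sourceSigma_le hN) hN.indep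
    (S := {s}ᶜ) (T := {s}) disjoint_compl_left
  refine indep_sup_of_indep (iSup₂_le fun s' _ => N.sourceSigma_le hN s') (N.sourceSigma_le hN s)
    h𝓤 (indep_of_indep_of_le_right hind (le_iSup₂_of_le s rfl le_rfl)) ?_
  exact (indep_of_indep_of_le_right h𝓤N
    (sup_le (iSup₂_le fun s' _ => le_iSup N.sourceSigma s') (le_iSup N.sourceSigma s))).symm

theorem indep_othersSigma_fading [IsProbabilityMeasure Pr] (hN : N.IsPoissonRayleigh Pr)
    (h𝓤 : 𝓤 ≤ mΩ) (h𝓤N : Indep 𝓤 (⨆ s, N.sourceSigma s) Pr) (i : Fin T) (j : ℕ) :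
    Indep (othersSigma (N.stationSigma 𝓤) (N.fading i) j)
      (MeasurableSpace.comap (N.fading i j) inferInstance) Pr := by
  refine indep_of_indep_of_le_left (N.indep_source hN h𝓤 h𝓤N (Sum.inr (i, j)))
    (sup_le (sup_le_sup_right (iSup_le fun l => ?_) 𝓤) (iSup_le fun k => ?_))
  · exact le_iSup₂_of_le (f := fun s (_ : s ∈ ({Sum.inr (i, j)}ᶜ : Set (Fin T ⊕ (Fin T × ℕ)))) =>
      N.sourceSigma s) (Sum.inl l) (by simp) le_rfl
  · refine le_trans ?_ le_sup_left
    exact le_iSup₂_of_le (f := fun s (_ : s ∈ ({Sum.inr (i, j)}ᶜ : Set (Fin T ⊕ (Fin T × ℕ)))) =>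
      N.sourceSigma s) (Sum.inr (i, k.1)) (by simpa using k.2) le_rfl

theorem indep_pointSigma_otherStationSigma [IsProbabilityMeasure Pr] (hN : N.IsPoissonRayleigh Pr)
    (h𝓤 : 𝓤 ≤ mΩ) (h𝓤N : Indep 𝓤 (⨆ s, N.sourceSigma s) Pr) (i : Fin T) :
    Indep (pointSigma (N.stations i)) (N.otherStationSigma 𝓤 i) Pr := by
  refine (indep_of_indep_of_le_left (N.indep_source hN h𝓤 h𝓤N (Sum.inl i))
    (sup_le_sup_right (iSup_le fun l => ?_) 𝓤)).symm
  exact le_iSup₂_of_le (f := fun s (_ : s ∈ ({Sum.inl i}ᶜ : Set (Fin T ⊕ (Fin T × ℕ)))) =>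
    N.sourceSigma s) (Sum.inl l.1) (by simpa using l.2) le_rfl

theorem measurable_dist (hN : N.IsPoissonRayleigh Pr) (i : Fin T) (k : ℕ) :
    Measurable (N.dist i k) :=
  measurable_nthDist' (hN.stations_ppp i) k

theorem measurableSet_coverEvent (hN : N.IsPoissonRayleigh Pr) (i : Fin T) (j : ℕ) :
    MeasurableSet (N.coverEvent i j) := by
  have hrec : ∀ k, Measurable (N.received i k) := fun k =>
    Measurable.ennreal_ofReal ((measurable_const.mul (hN.fading_measurable i k)).mul
      ((N.measurable_dist hN i k).pow_const _))
  have hsum : Measurable fun ω => ∑' k : {k : ℕ // k ≠ j}, N.received i k ω :=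
    Measurable.tsum fun k => hrec k
  exact measurableSet_le measurable_const ((hrec j).div (hsum.const_add _))

theorem ae_fading_pos (hμ : 0 < N.μ) (hN : N.IsPoissonRayleigh Pr) (i : Fin T) :
    ∀ᵐ ω ∂Pr, ∀ k, 0 < N.fading i k ω := by
  refine ae_all_iff.2 fun k => ?_
  have h : ∀ᵐ x ∂(Pr.map (N.fading i k)), 0 < x := by
    rw [hN.fading_law, ae_iff]
    convert! expMeasure_Iic_zero hμ using 2
    ext x
    simp
  exact ae_of_ae_map (hN.fading_measurable i k).aemeasurable h

/-- The interference is the supremum of its partial sums in `[0, ∞]`, so the SINR inequality is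
equivalent to all truncated ones; each is then rescaled by `r j ^ α / P`. -/
theorem mem_coverEvent_iff (hP : ∀ i, 0 < N.power i) (hN₀ : ∀ i, 0 ≤ N.noise i)
    (hβ : ∀ i, 0 < N.threshold i) (i : Fin T) (j : ℕ) {ω : Ω} (hr : ∀ k, 0 < N.dist i k ω)
    (hH : ∀ k, 0 < N.fading i k ω) :
    ω ∈ N.coverEvent i j ↔ ∀ n, requiredFading N.α (N.threshold i)
      (N.threshold i * N.noise i / N.power i) (fun k => N.dist i k ω) (fun k => N.fading i k ω) j n
        ≤ N.fading i j ω := by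
  set α := N.α
  set β := N.threshold i with hβdef
  set P := N.power i with hPdef
  have hP0 : 0 < P := hP i
  have hβ0 : 0 < β := hβ i
  have hrα : ∀ k, 0 < N.dist i k ω ^ α := fun k => Real.rpow_pos_of_pos (hr k) α
  have hrec : ∀ k, N.received i k ω =
      ENNReal.ofReal (P * N.fading i k ω / N.dist i k ω ^ α) := fun k => by
    rw [received, Real.rpow_neg (hr k).le, div_eq_mul_inv]
  have hpos : ∀ k, 0 < P * N.fading i k ω / N.dist i k ω ^ α := fun k =>
    div_pos (mul_pos hP0 (hH k)) (hrα k)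
  have hsum : ∑' k : {k : ℕ // k ≠ j}, N.received i k ω =
      ⨆ n : ℕ, ENNReal.ofReal (∑ k ∈ (Finset.range n).erase j,
        P * N.fading i k ω / N.dist i k ω ^ α) := by
    have h1 : ∑' k : {k : ℕ // k ≠ j}, N.received i k ω =
        ∑' k, Set.indicator {k | k ≠ j} (fun k => N.received i k ω) k :=
      tsum_subtype {k | k ≠ j} fun k => N.received i k ω
    rw [h1, ENNReal.tsum_eq_iSup_nat]
    refine iSup_congr fun n => ?_
    rw [ENNReal.ofReal_sum_of_nonneg fun k _ => (hpos k).le, ← Finset.filter_ne',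
      Finset.sum_filter]
    refine Finset.sum_congr rfl fun k _ => ?_
    simp only [Set.indicator_apply, Set.mem_ofPred_eq, hrec]
  have hmem : ω ∈ N.coverEvent i j ↔ ENNReal.ofReal β * (ENNReal.ofReal (N.noise i) +
      ∑' k : {k : ℕ // k ≠ j}, N.received i k ω) ≤ N.received i j ω := by
    -- The numerator is positive and finite, so clearing the denominator is legitimate even if that
    -- denominator is 0 or `∞`.
    refine ENNReal.le_div_iff_mul_le (Or.inr ?_) (Or.inr ?_)
    · rw [hrec]
      exact (ENNReal.ofReal_pos.2 (hpos j)).ne'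
    · exact ENNReal.ofReal_ne_top
  rw [hmem, hsum, ENNReal.add_iSup, ENNReal.mul_iSup, iSup_le_iff]
  refine forall_congr' fun n => ?_
  have hS0 : 0 ≤ ∑ k ∈ (Finset.range n).erase j, P * N.fading i k ω / N.dist i k ω ^ α :=
    Finset.sum_nonneg fun k _ => (hpos k).le
  rw [← ENNReal.ofReal_add (hN₀ i) hS0, ← ENNReal.ofReal_mul hβ0.le, hrec,
    ENNReal.ofReal_le_ofReal_iff (hpos j).le, le_div_iff₀ (hrα j), mul_comm P,
    ← div_le_iff₀ hP0]
  refine Eq.to_iff (congrArg (· ≤ _) ?_)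
  rw [requiredFading, mul_add, add_mul, add_div, Finset.mul_sum, Finset.sum_mul, Finset.sum_div]
  congr 1
  · ring
  · refine Finset.sum_congr rfl fun k _ => ?_
    rw [max_eq_left (hH k).le, Real.div_rpow (hr j).le (hr k).le]
    field_simp

theorem measure_inter_coverEvent [IsProbabilityMeasure Pr]
    (hμ : 0 < N.μ) (hlam : ∀ i, 0 < N.intensity i)
    (hP : ∀ i, 0 < N.power i) (hN₀ : ∀ i, 0 ≤ N.noise i) (hβ : ∀ i, 0 < N.threshold i)
    (hN : N.IsPoissonRayleigh Pr) (h𝓤 : 𝓤 ≤ mΩ) (h𝓤N : Indep 𝓤 (⨆ s, N.sourceSigma s) Pr)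
    (i : Fin T) (j : ℕ) {G : Set Ω} (hG : MeasurableSet[N.stationSigma 𝓤] G) :
    Pr (G ∩ N.coverEvent i j) = ∫⁻ ω, G.indicator 1 ω * coverGivenDistances N.α (N.threshold i) N.μ
      (N.threshold i * N.noise i / N.power i) (fun k => N.dist i k ω) j ∂Pr := by
  have hpos := N.ae_fading_pos hμ hN i
  have hc : 0 ≤ N.threshold i * N.noise i / N.power i :=
    div_nonneg (mul_nonneg (hβ i).le (hN₀ i)) (hP i).le
  rw [← measure_inter_forall_requiredFading_le hμ (N.stationSigma_le hN h𝓤)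
    (hN.fading_measurable i) (hN.fading_law i) (N.indep_othersSigma_fading hN h𝓤 h𝓤N i) (hβ i) hc
    (r := N.dist i) (fun k => (measurable_nthDist (N.stations i) k).mono
      ((le_iSup (fun i => pointSigma (N.stations i)) i).trans le_sup_left) le_rfl)
    (fun k ω => nthDist_nonneg _ _) hpos j hG]
  refine measure_congr ?_
  filter_upwards [hpos, ae_isLocallyFiniteInfinite (hN.stations_ppp i) (hlam i),
    ae_encard_zero (hN.stations_ppp i)] with ω hH hS h0
  exact propext (and_congr_right fun _ =>
    N.mem_coverEvent_iff hP hN₀ hβ i j (hS.nthDist_pos h0) hH)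

/-- The comparison holds on every event of the full station information, hence for any policy that
knows less. -/
theorem measure_inter_coverEvent_le [IsProbabilityMeasure Pr] (hα : 0 < N.α)
    (hμ : 0 < N.μ) (hlam : ∀ i, 0 < N.intensity i)
    (hP : ∀ i, 0 < N.power i) (hN₀ : ∀ i, 0 ≤ N.noise i) (hβ : ∀ i, 0 < N.threshold i)
    (hN : N.IsPoissonRayleigh Pr) (h𝓤 : 𝓤 ≤ mΩ) (h𝓤N : Indep 𝓤 (⨆ s, N.sourceSigma s) Pr)
    (i : Fin T) (j : ℕ) {G : Set Ω} (hG : MeasurableSet[N.stationSigma 𝓤] G) :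
    Pr (G ∩ N.coverEvent i j) ≤ Pr (G ∩ N.coverEvent i 0) := by
  rw [N.measure_inter_coverEvent hμ hlam hP hN₀ hβ hN h𝓤 h𝓤N i j hG,
    N.measure_inter_coverEvent hμ hlam hP hN₀ hβ hN h𝓤 h𝓤N i 0 hG]
  refine lintegral_mono_ae ?_
  filter_upwards [ae_isLocallyFiniteInfinite (hN.stations_ppp i) (hlam i),
    ae_encard_zero (hN.stations_ppp i)] with ω hS h0
  gcongr
  exact coverGivenDistances_le_zero hα (hβ i) hμ
    (div_nonneg (mul_nonneg (hβ i).le (hN₀ i)) (hP i).le) (hS.nthDist_pos h0) hS.monotone_nthDist j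

theorem measure_inter_coverEvent_zero [IsProbabilityMeasure Pr] (hα : 2 < N.α)
    (hμ : 0 < N.μ) (hlam : ∀ i, 0 < N.intensity i)
    (hP : ∀ i, 0 < N.power i) (hN₀ : ∀ i, 0 ≤ N.noise i) (hβ : ∀ i, 0 < N.threshold i)
    (hN : N.IsPoissonRayleigh Pr) (h𝓤 : 𝓤 ≤ mΩ) (h𝓤N : Indep 𝓤 (⨆ s, N.sourceSigma s) Pr)
    (l : ℕ) (i : Fin T) {A : Set Ω} (hA : MeasurableSet[N.info (l + 1) ⊔ 𝓤] A) :
    Pr (A ∩ N.coverEvent i 0) = ∫⁻ ω in A, ENNReal.ofReal (N.score l i ω) ∂Pr := by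
  set c := N.threshold i * N.noise i / N.power i with hcdef
  have hc : 0 ≤ c := div_nonneg (mul_nonneg (hβ i).le (hN₀ i)) (hP i).le
  have hAG := N.info_le_stationSigma (l + 1) 𝓤 A hA
  have hAm := N.stationSigma_le hN h𝓤 A hAG
  let w : Ω → ENNReal := fun ω => ENNReal.ofReal (Real.exp (-(N.μ * (c * N.dist i 0 ω ^ N.α))))
  let att : Ω → ℕ → ENNReal := fun ω k =>
    ENNReal.ofReal (attenuation N.α (N.threshold i) (N.dist i 0 ω) (N.dist i k ω))
  -- The noise factor and the interferers of ranks 1 to `l` are known; only the ranks above `l`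
  -- remain to be averaged.
  let Y : Ω → ENNReal := fun ω => A.indicator 1 ω * (w ω * ∏ k ∈ Finset.Ico 1 (l + 1), att ω k)
  have hatt0 : ∀ ω k, 0 ≤ attenuation N.α (N.threshold i) (N.dist i 0 ω) (N.dist i k ω) :=
    fun ω k => attenuation_nonneg (hβ i) (nthDist_nonneg _ _) (nthDist_nonneg _ _)
  have hatt1 : ∀ ω k, att ω k ≤ 1 := fun ω k => by
    rw [ENNReal.ofReal_le_one]
    exact attenuation_le_one (hβ i) (nthDist_nonneg _ _) (nthDist_nonneg _ _)
  have hw1 : ∀ ω, w ω ≤ 1 := fun ω => by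
    rw [ENNReal.ofReal_le_one, Real.exp_le_one_iff, neg_nonpos]
    exact mul_nonneg hμ.le (mul_nonneg hc (Real.rpow_nonneg (nthDist_nonneg _ _) _))
  have hd : ∀ k ≤ l, Measurable[knownSigma (N.stations i) (N.otherStationSigma 𝓤 i) l]
      (N.dist i k) := fun k hk => measurable_nthDist_knownSigma _ _ hk
  have hYm : Measurable[knownSigma (N.stations i) (N.otherStationSigma 𝓤 i) l] Y := by
    have hA1 : Measurable[knownSigma (N.stations i) (N.otherStationSigma 𝓤 i) l]
        (A.indicator (1 : Ω → ENNReal)) :=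
      measurable_const.indicator (N.info_le_knownSigma l 𝓤 i A hA)
    exact hA1.mul (N.measurable_weight_of_dist hd)
  have hY1 : ∀ ω, Y ω ≤ 1 := fun ω =>
    mul_le_one' (Set.indicator_le_self' (fun _ _ => zero_le) ω)
      (mul_le_one' (hw1 ω) (Finset.prod_le_one' fun k _ => hatt1 ω k))
  rw [N.measure_inter_coverEvent hμ hlam hP hN₀ hβ hN h𝓤 h𝓤N i 0 hAG,
    ← lintegral_indicator hAm]
  refine Eq.trans (lintegral_congr fun ω => ?_) ((lintegral_mul_iInf_prod_attenuation
    (hN.stations_ppp i) (hlam i) (N.otherStationSigma_le hN h𝓤 i)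
    (N.indep_pointSigma_otherStationSigma hN h𝓤 h𝓤N i) hα (hβ i) hYm hY1).trans
    (lintegral_congr fun ω => ?_))
  · show A.indicator 1 ω * ⨅ n : ℕ, w ω * ∏ k ∈ (Finset.range n).erase 0, att ω k =
      Y ω * ⨅ n : ℕ, ∏ p ∈ Finset.Ico (l + 1) n, att ω p
    have herase : ∀ n, (Finset.range n).erase 0 = Finset.Ico 1 n := fun n => by
      ext k
      simp only [Finset.mem_erase, Finset.mem_range, Finset.mem_Ico]
      omega
    have hanti : ∀ m, Antitone fun n : ℕ => ∏ p ∈ Finset.Ico m n, att ω p := fun m a b hab =>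
      Finset.prod_le_prod_of_subset_of_le_one' (Finset.Ico_subset_Ico_right hab)
        fun p _ _ => hatt1 ω p
    have hanti' : Antitone fun n : ℕ => w ω * ∏ p ∈ Finset.Ico 1 n, att ω p := fun a b hab =>
      mul_le_mul_right (hanti 1 hab) _
    simp_rw [herase]
    -- Shifting the truncation by `l + 1` changes neither infimum and ensures that the known ranks
    -- `1, …, l` occur in every partial product.
    rw [← hanti'.iInf_nat_add (l + 1), ← (hanti (l + 1)).iInf_nat_add (l + 1)]
    simp_rw [fun n => (Finset.prod_Ico_consecutive (att ω) (Nat.le_add_left 1 l)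
      (Nat.le_add_left (l + 1) n)).symm, ← mul_assoc (w ω)]
    rw [← ENNReal.mul_iInf fun htop => absurd htop (ne_top_of_le_ne_top ENNReal.one_ne_top
      (mul_le_one' (hw1 ω) (Finset.prod_le_one' fun k _ => hatt1 ω k)))]
    simp only [Y, mul_assoc]
  · by_cases hω : ω ∈ A
    · simp only [Y, w, att, Set.indicator_of_mem hω, Pi.one_apply, one_mul, score]
      rw [ENNReal.ofReal_mul (mul_nonneg (Real.exp_pos _).le
        (Finset.prod_nonneg fun k _ => hatt0 ω k)), ENNReal.ofReal_mul (Real.exp_pos _).le,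
        ENNReal.ofReal_prod_of_nonneg fun k _ => hatt0 ω k]
      rfl
    · simp only [Y, Set.indicator_of_notMem hω, zero_mul]

theorem coverage_eq (hN : N.IsPoissonRayleigh Pr) {π : Ω → Fin T × ℕ} (hπ : Measurable π) :
    N.coverage Pr π = Pr.real (chosenEvent N.coverEvent π) := by
  have hE := measurableSet_chosenEvent (N.measurableSet_coverEvent hN) hπ
  rw [← integral_indicator_one hE]
  rfl

/-- The conclusions for the information on the `l + 1` nearest distances of each technology. -/
theorem condExp_covered_and_optimal [IsProbabilityMeasure Pr] (hT : 0 < T) (hα : 2 < N.α)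
    (hμ : 0 < N.μ) (hlam : ∀ i, 0 < N.intensity i)
    (hP : ∀ i, 0 < N.power i) (hN₀ : ∀ i, 0 ≤ N.noise i) (hβ : ∀ i, 0 < N.threshold i)
    (hN : N.IsPoissonRayleigh Pr) (h𝓤 : 𝓤 ≤ mΩ) (h𝓤N : Indep 𝓤 (⨆ s, N.sourceSigma s) Pr)
    (l : ℕ) :
    (∀ i, Pr[N.covered i 0 | N.techInfo (l + 1) i] =ᵐ[Pr] N.score l i) ∧
      (∀ i, Pr[N.covered i 0 | N.info (l + 1) ⊔ 𝓤] =ᵐ[Pr] N.score l i) ∧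
      (∃ π : Ω → Fin T × ℕ, Measurable[N.info (l + 1) ⊔ 𝓤] π ∧ FollowsRule Pr (N.score l) π) ∧
      (∀ π : Ω → Fin T × ℕ, Measurable[N.info (l + 1) ⊔ 𝓤] π → FollowsRule Pr (N.score l) π →
        N.IsOptimalPolicy (N.info (l + 1) ⊔ 𝓤) Pr π) := by
  have hF : N.info (l + 1) ⊔ 𝓤 ≤ mΩ :=
    (N.info_le_stationSigma _ 𝓤).trans (N.stationSigma_le hN h𝓤)
  have hC := N.measurableSet_coverEvent hN
  have hscore : ∀ i A, MeasurableSet[N.info (l + 1) ⊔ 𝓤] A →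
      Pr (A ∩ N.coverEvent i 0) = ∫⁻ ω in A, ENNReal.ofReal (N.score l i ω) ∂Pr := fun i A hA =>
    N.measure_inter_coverEvent_zero hα hμ hlam hP hN₀ hβ hN h𝓤 h𝓤N l i hA
  have hdom : ∀ i j A, MeasurableSet[N.info (l + 1) ⊔ 𝓤] A →
      Pr (A ∩ N.coverEvent i j) ≤ Pr (A ∩ N.coverEvent i 0) := fun i j A hA =>
    N.measure_inter_coverEvent_le (by linarith) hμ hlam hP hN₀ hβ hN h𝓤 h𝓤N i j
      (N.info_le_stationSigma _ 𝓤 A hA)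
  have hcond : ∀ i, Pr[N.covered i 0 | N.info (l + 1) ⊔ 𝓤] =ᵐ[Pr] N.score l i := fun i =>
    condExp_indicator_eq_score hF (hC i 0) (N.measurable_score_info l 𝓤 i)
      (N.score_nonneg hβ l i) (hscore i)
  refine ⟨fun i => ?_, hcond, exists_policy_followsRule hT (N.measurable_score_info l 𝓤), ?_⟩
  · exact condExp_eq_of_le ((le_iSup (N.techInfo (l + 1)) i).trans le_sup_left) hF
      (N.measurable_score_techInfo l i) (hcond i)
  · intro π hπ hrule
    refine ⟨hπ, fun π' hπ' => ?_⟩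
    rw [N.coverage_eq hN (hπ'.mono hF le_rfl), N.coverage_eq hN (hπ.mono hF le_rfl)]
    refine ENNReal.toReal_mono (measure_ne_top _ _) ?_
    -- For the rule the bound by the mean score is an equality, since it almost surely selects rank
    -- 0; other policies satisfy only the inequality, and their scores are pointwise smaller or
    -- equal.
    rw [measure_chosenEvent_eq hF hC hscore hπ (hrule.mono fun ω h => h.2)]
    refine (measure_chosenEvent_le hF hC hscore hdom hπ').trans (lintegral_mono_ae ?_)
    filter_upwards [hrule] with ω hω
    exact ENNReal.ofReal_le_ofReal (hω.1 _)

end Random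

end Network

end CellularNetwork

theorem mainTheorem5 {T : ℕ} (hT : 0 < T) {Ω : Type*} (𝓤 : MeasurableSpace Ω)
    [mΩ : MeasurableSpace Ω]
    (Pr : Measure Ω) [IsProbabilityMeasure Pr] (N : CellularNetwork.Network T Ω)
    (hα : 2 < N.α) (hμ : 0 < N.μ)
    (hlam : ∀ i, 0 < N.intensity i) (hP : ∀ i, 0 < N.power i)
    (hN₀ : ∀ i, 0 ≤ N.noise i) (hβ : ∀ i, 0 < N.threshold i)
    (hN : N.IsPoissonRayleigh Pr)
    -- `𝓤`: extra randomness available to the policies, independent of the network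
    (h𝓤 : 𝓤 ≤ mΩ) (h𝓤N : Indep 𝓤 (⨆ s, N.sourceSigma s) Pr) :
    -- the integrals in the coverage expressions converge
    (∀ i, ∀ a b : ℝ, 0 < a → 0 < b →
      IntegrableOn (CellularNetwork.kernelFn N.α (N.threshold i) a) (Set.Ioi b)) ∧
    -- nearest distances known
    ((∀ i, Pr[N.covered i 0 | N.techInfo 1 i] =ᵐ[Pr] N.scoreOne i) ∧
      (∀ i, Pr[N.covered i 0 | N.info 1 ⊔ 𝓤] =ᵐ[Pr] N.scoreOne i) ∧
      (∃ π : Ω → Fin T × ℕ, Measurable[N.info 1 ⊔ 𝓤] π ∧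
        CellularNetwork.FollowsRule Pr N.scoreOne π) ∧
      (∀ π : Ω → Fin T × ℕ, Measurable[N.info 1 ⊔ 𝓤] π →
        CellularNetwork.FollowsRule Pr N.scoreOne π →
        N.IsOptimalPolicy (N.info 1 ⊔ 𝓤) Pr π)) ∧
    -- two nearest distances known
    ((∀ i, Pr[N.covered i 0 | N.techInfo 2 i] =ᵐ[Pr] N.scoreTwo i) ∧
      (∀ i, Pr[N.covered i 0 | N.info 2 ⊔ 𝓤] =ᵐ[Pr] N.scoreTwo i) ∧
      (∃ π : Ω → Fin T × ℕ, Measurable[N.info 2 ⊔ 𝓤] π ∧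
        CellularNetwork.FollowsRule Pr N.scoreTwo π) ∧
      (∀ π : Ω → Fin T × ℕ, Measurable[N.info 2 ⊔ 𝓤] π →
        CellularNetwork.FollowsRule Pr N.scoreTwo π →
        N.IsOptimalPolicy (N.info 2 ⊔ 𝓤) Pr π))
 := by
  refine ⟨fun i a b ha hb => CellularNetwork.integrableOn_kernelFn hα (hβ i) ha hb, ?_, ?_⟩
  · have h := N.condExp_covered_and_optimal hT hα hμ hlam hP hN₀ hβ hN h𝓤 h𝓤N 0
    rwa [N.score_zero] at h
  · have h := N.condExp_covered_and_optimal hT hα hμ hlam hP hN₀ hβ hN h𝓤 h𝓤N 1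
    rwa [N.score_one] at h
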